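/- **Setting.** Let $0<\varepsilon<1$, $0<\delta<1$, $\gamma\ge 1$, $f>0$ with $(1+\delta)\gamma^2 f<1$, $\tau\ge 1$, $\lambda>0$, $\Delta,\kappa\in\mathbb N$, $0<\phi<\frac1{2-\delta}$, and put $p=2^{-\kappa}$, $$\ell=\frac{4(1+3\varepsilon)}{\varepsilon^2 f\,[1-(1+\delta)\gamma^2 f]^{\Delta+1}}\max\{\Delta,\tau\}\,\gamma^4\lambda,\qquad \Phi=\frac{4(1+\delta)\gamma^2 f(\ell+3\Delta)}{\varepsilon},\qquad s=\frac{2(1+\delta)\gamma^2\Phi}{f}.$$ Assume also $\ell/(\phi(2-\delta))\le s/2$. An *execution* of $L$ rounds is generated as follows, by an arbitrary (randomized, adaptive) environment, adversary, network and honest protocol. At the start of round $r$ it is decided, depending on the past, that $n_r\ge 1$ honest and $t_r\le(1-\delta)n_r$ corrupted parties are active, in which order they act, and which $n^{\mathcal H}_r=\lceil\phi(2-\delta)n_r\rceil$ of the honest parties form $\mathcal H$ (the $\phi$-fraction honest subset). Each honest party makes one fresh query to the random oracle in the round, each corrupted party at most one. A query has a target $T\in\mathbb N$, $T\ge1$,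 chosen depending on everything that happened before. The oracle's reply is uniform on the $2^\kappa$ hash values, and the query creates a fruit, of difficulty $1/T$, if the reply lies in a range of $T$ hash values fixed in advance with the query (disjoint from the range that yields a block). The execution is $(\gamma,s)$-respecting if $\max_{r\in S}n_r\le\gamma\min_{r\in S}n_r$ for every nonempty set $S$ of at most $s$ consecutive rounds; the environment is $(\gamma,s)$-respecting if every possible execution is. Round $r$ is *good* if $\frac f{2\gamma^2}\le p\,n_r T\le(1+\delta)\gamma^2 f$ for every target $T$ that an honest party queries with in round $r$. For a set $S$ of rounds let $n(S)=\sum_{r\in S}n_r$, $n^{\mathcal H}(S)=\sum_{r\in S}n_r^{\mathcal H}$, let $D(S)$ and $D^{\mathcal H}(S)$ be the total difficulty of the fruits created in $S$ by honest parties and by parties in $\mathcal H$, let $J$ be the set of adversarial queries made in $S$, and $A(J)$ the total difficulty of the fruits they create. An execution is *fruit-typical* if (a) for every set $S$ of at least $\ell$ consecutive good rounds, $D(S)<(1+\varepsilon)\,p\,n(S)$; (b) for every set $S$ of at least $\ell$ consecutive good rounds such that each query in $J$, made in round $r$ with target $T$, satisfies $\frac f{2\tau\gamma^3}\le p\,n_rT\le(1+\delta)\tau\gamma^3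 f$, one has $D(S)+A(J)<(1+\varepsilon)\,p\,(n(S)+|J|)$; (c) for every set $S$ of at least $\ell/(\phi(2-\delta))$ consecutive good rounds, $D^{\mathcal H}(S)>(1-\varepsilon)\,p\,n^{\mathcal H}(S)$. **Theorem.** There is an absolute constant $C>0$ such that, for all parameters as above and every execution of $L$ rounds in a $(\gamma,s)$-respecting environment, the probability that the execution is not fruit-typical is at most $C\,L\,e^{-\lambda}$. -/

import Mathlib

noncomputable section

namespace FruitChains

/-- The numerical parameters: concentration quality `ε`, honest advantage `δ`, fluctuation bound `γ`
on the number of parties, expected mining rate `f`, dampening filter `τ`, security parameter `lam`,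
power fraction `φ`, network delay `Δ` and hash length `κ`. -/
structure Params where
  ε : ℝ
  δ : ℝ
  γ : ℝ
  f : ℝ
  τ : ℝ
  lam : ℝ
  φ : ℝ
  Δ : ℕ
  κ : ℕ

namespace Params

/-- The probability `p = 2 ^ (-κ)` of a single hash value. -/
def p (par : Params) : ℝ := 1 / 2 ^ par.κ

/-- `ℓ = 4 (1 + 3 ε) / (ε² f [1 - (1 + δ) γ² f] ^ (Δ + 1)) * max {Δ, τ} * γ⁴ * lam`. -/
def ell (par : Params) : ℝ :=
  4 * (1 + 3 * par.ε) /
      (par.ε ^ 2 * par.f * (1 - (1 + par.δ) * par.γ ^ 2 * par.f) ^ (par.Δ + 1)) *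
    max (par.Δ : ℝ) par.τ * par.γ ^ 4 * par.lam

/-- The epoch length `Φ = 4 (1 + δ) γ² f (ℓ + 3 Δ) / ε`. -/
def epoch (par : Params) : ℝ :=
  4 * (1 + par.δ) * par.γ ^ 2 * par.f * (par.ell + 3 * par.Δ) / par.ε

/-- `s = 2 (1 + δ) γ² Φ / f`. -/
def s (par : Params) : ℝ := 2 * (1 + par.δ) * par.γ ^ 2 * par.epoch / par.f

/-- The least number of rounds `ℓ / (φ (2 - δ))` over which a `φ`-fraction is considered. -/
def ellFraction (par : Params) : ℝ := par.ell / (par.φ * (2 - par.δ))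

/-- The ranges of the parameters. The last condition says that a set of at least `ℓ / (φ (2 - δ))`
rounds can be cut into parts of at least that many and at most `s` rounds. -/
structure Valid (par : Params) : Prop where
  ε_pos : 0 < par.ε
  ε_lt_one : par.ε < 1
  δ_pos : 0 < par.δ
  δ_lt_one : par.δ < 1
  one_le_γ : 1 ≤ par.γ
  f_pos : 0 < par.f
  rate_lt_one : (1 + par.δ) * par.γ ^ 2 * par.f < 1
  one_le_τ : 1 ≤ par.τ
  lam_pos : 0 < par.lam
  φ_pos : 0 < par.φ
  φ_lt : par.φ < 1 / (2 - par.δ)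
  ellFraction_le : par.ellFraction ≤ par.s / 2

end Params

/-- A (fresh) `compute` query to the random oracle, described by the targets it is made for. With
2-for-1 sortition a hash value `y < blockTarget` gives a block, and a hash value `y` with
`blockTarget ≤ y < blockTarget + target` gives a fruit of target `target`. -/
structure Query (κ : ℕ) where
  blockTarget : ℕ
  target : ℕ
  target_pos : 0 < target
  target_le : blockTarget + target ≤ 2 ^ κ

/-- The difficulty (the inverse of the target) of the fruit that the query `q` creates when the
oracle replies `y`; it is `0` if no fruit is created. -/
def fruitDifficulty {κ : ℕ} (q : Query κ) (y : Fin (2 ^ κ)) : ℝ :=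
  if q.blockTarget ≤ (y : ℕ) ∧ (y : ℕ) < q.blockTarget + q.target then 1 / (q.target : ℝ) else 0

/-- Who is active in a round: `n` honest parties and `t` corrupted parties with `t ≤ (1 - δ) n`, a
set `H` of `⌈φ (2 - δ) n⌉` of the honest parties, and the order in which they are activated. Each
honest party makes one query in the round, each corrupted party at most one. -/
structure RoundPlan (par : Params) where
  n : ℕ
  t : ℕ
  n_pos : 0 < n
  t_le : (t : ℝ) ≤ (1 - par.δ) * n
  H : Finset (Fin n)
  H_card : H.card = ⌈par.φ * (2 - par.δ) * n⌉₊
  order : Fin (n + t) ≃ Fin n ⊕ Fin t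

namespace RoundPlan

/-- A party active in the round: `Sum.inl i` is honest, `Sum.inr j` is corrupted. -/
abbrev Party {par : Params} (P : RoundPlan par) : Type := Fin P.n ⊕ Fin P.t

end RoundPlan

/-- One query of a round: who made it, the query, and the reply of the random oracle. -/
structure QueryRecord {par : Params} (P : RoundPlan par) where
  party : P.Party
  query : Query par.κ
  reply : Fin (2 ^ par.κ)

/-- Everything that the analysis looks at in one round. -/
structure RoundRecord (par : Params) where
  plan : RoundPlan par
  log : List (QueryRecord plan)

/-- An arbitrary protocol run by the honest parties together with an arbitrary environment,
adversary and network. `State` is the joint configuration of all of them (local chains, messages in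
transit, internal memories, everything seen so far). All choices are adaptive and randomized:
at the beginning of a round it is decided who is active, and when a party is activated its query is
decided (the adversary may also skip it, answer `none`), each time from the current state; then the
reply of the oracle becomes known. -/
structure System (par : Params) (State : Type) where
  init : PMF State
  plan : State → PMF (RoundPlan par × State)
  honestQuery : (P : RoundPlan par) → Fin P.n → State → PMF (Query par.κ × State)
  advQuery : (P : RoundPlan par) → Fin P.t → State → PMF (Option (Query par.κ) × State)
  receive : State → Fin (2 ^ par.κ) → State

namespace System

variable {par : Params} {State : Type}

/-- The listed parties make their queries, one after the other; each reply of the random oracle is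
uniform on the `κ`-bit values, independently of the past. -/
def runQueries (sys : System par State) (P : RoundPlan par) :
    List P.Party → State → PMF (List (QueryRecord P) × State)
  | [], x => PMF.pure ([], x)
  | Sum.inl i :: as, x =>
      (sys.honestQuery P i x).bind fun qx =>
        (PMF.uniformOfFintype (Fin (2 ^ par.κ))).bind fun y =>
          (runQueries sys P as (sys.receive qx.2 y)).map fun res =>
            (⟨Sum.inl i, qx.1, y⟩ :: res.1, res.2)
  | Sum.inr j :: as, x =>
      (sys.advQuery P j x).bind fun qx =>
        match qx.1 with
        | none => runQueries sys P as qx.2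
        | some q =>
            (PMF.uniformOfFintype (Fin (2 ^ par.κ))).bind fun y =>
              (runQueries sys P as (sys.receive qx.2 y)).map fun res =>
                (⟨Sum.inr j, q, y⟩ :: res.1, res.2)

/-- One round. -/
def runRound (sys : System par State) (x : State) : PMF (RoundRecord par × State) :=
  (sys.plan x).bind fun Px =>
    (sys.runQueries Px.1 (List.ofFn Px.1.order) Px.2).map fun res => (⟨Px.1, res.1⟩, res.2)

/-- `L` rounds from a given state. -/
def runRounds (sys : System par State) : ℕ → State → PMF (List (RoundRecord par))
  | 0, _ => PMF.pure []
  | L + 1, x =>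
      (sys.runRound x).bind fun res =>
        (runRounds sys L res.2).map fun rest => res.1 :: rest

/-- The law of an execution of `L` rounds, recorded as the list of its rounds. -/
def execution (sys : System par State) (L : ℕ) : PMF (List (RoundRecord par)) :=
  sys.init.bind (sys.runRounds L)

end System

/-- The numbers of honest parties are `(γ, s)`-respecting: in any at most `s` consecutive rounds
(contiguous sublist of the execution) the largest is at most `γ` times the smallest. -/
def IsRespecting {par : Params} (γ s : ℝ) (E : List (RoundRecord par)) : Prop :=
  ∀ S : List (RoundRecord par), S <:+: E → (S.length : ℝ) ≤ s →
    ∀ a ∈ S, ∀ b ∈ S, (a.plan.n : ℝ) ≤ γ * b.plan.n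

/-- The system is `(γ, s)`-respecting over `L` rounds: every possible execution is. -/
def System.Respecting {par : Params} {State : Type} (sys : System par State) (L : ℕ)
    (γ s : ℝ) : Prop :=
  ∀ E ∈ (sys.execution L).support, IsRespecting γ s E

namespace RoundRecord

variable {par : Params}

/-- The round is good: `f / (2 γ²) ≤ p n T_min` and `p n T_max ≤ (1 + δ) γ² f`, where `T_min` and
`T_max` are the least and greatest targets for which honest parties query in this round. -/
def Good (R : RoundRecord par) : Prop :=
  ∀ e ∈ R.log, e.party.isLeft →
    par.f / (2 * par.γ ^ 2) ≤ par.p * R.plan.n * e.query.target ∧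
      par.p * R.plan.n * e.query.target ≤ (1 + par.δ) * par.γ ^ 2 * par.f

/-- Every adversarial query of the round, with target `T`, satisfies
`f / (2 τ γ³) ≤ p n T ≤ (1 + δ) τ γ³ f`. -/
def AdvBounded (R : RoundRecord par) : Prop :=
  ∀ e ∈ R.log, e.party.isRight →
    par.f / (2 * par.τ * par.γ ^ 3) ≤ par.p * R.plan.n * e.query.target ∧
      par.p * R.plan.n * e.query.target ≤ (1 + par.δ) * par.τ * par.γ ^ 3 * par.f

/-- The total difficulty of the fruits of this round computed by the parties in `A`. -/
def difficulty (R : RoundRecord par) (A : Set R.plan.Party) : ℝ :=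
  open Classical in
  (R.log.map fun e => if e.party ∈ A then fruitDifficulty e.query e.reply else 0).sum

/-- Difficulty of the fruits computed by honest parties. -/
def D (R : RoundRecord par) : ℝ := R.difficulty {a | a.isLeft}

/-- Difficulty of the fruits computed by the parties in `H`. -/
def DH (R : RoundRecord par) : ℝ := R.difficulty {a | ∃ i ∈ R.plan.H, a = Sum.inl i}

/-- Difficulty of the fruits created by the adversarial queries. -/
def A (R : RoundRecord par) : ℝ := R.difficulty {a | a.isRight}

/-- The number of adversarial queries made in this round. -/
def numAdv (R : RoundRecord par) : ℕ := R.log.countP fun e => e.party.isRight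

end RoundRecord

section Sums

variable {par : Params} (S : List (RoundRecord par))

/-- `D(S)`. -/
def sumD : ℝ := (S.map RoundRecord.D).sum

/-- `D^H(S)`. -/
def sumDH : ℝ := (S.map RoundRecord.DH).sum

/-- `A(J)` for the set `J` of all adversarial queries in `S`. -/
def sumA : ℝ := (S.map RoundRecord.A).sum

/-- `n(S)`. -/
def sumN : ℝ := (S.map fun R => (R.plan.n : ℝ)).sum

/-- `n^H(S)`. -/
def sumNH : ℝ := (S.map fun R => (R.plan.H.card : ℝ)).sum

/-- `|J|` for the set `J` of all adversarial queries in `S`. -/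
def sumJ : ℝ := (S.map fun R => (R.numAdv : ℝ)).sum

end Sums

/-- Fruit-typical executions. A set of consecutive rounds is a contiguous sublist `S` of `E`. -/
structure FruitTypical {par : Params} (E : List (RoundRecord par)) : Prop where
  honest : ∀ S : List (RoundRecord par), S <:+: E → (∀ R ∈ S, R.Good) →
    par.ell ≤ S.length →
      sumD S < (1 + par.ε) * par.p * sumN S
  total : ∀ S : List (RoundRecord par), S <:+: E → (∀ R ∈ S, R.Good) →
    par.ell ≤ S.length → (∀ R ∈ S, R.AdvBounded) →
      sumD S + sumA S < (1 + par.ε) * par.p * (sumN S + sumJ S)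
  fraction : ∀ S : List (RoundRecord par), S <:+: E → (∀ R ∈ S, R.Good) →
    par.ellFraction ≤ S.length →
      (1 - par.ε) * par.p * sumNH S < sumDH S

end FruitChains

end

noncomputable section

namespace FruitChains

/-! The proof is an exponential-supermartingale argument. Each reply is uniform given the past, so a
query of target `T` creates difficulty with `E exp (θ X) = 1 + cumulant θ q ≤ exp (cumulant θ q)`.
Summing `θ X - cumulant` over the queries of any fixed class of parties therefore gives an exponent
whose exponential has mean at most 1, whatever the adaptive choices of queries. Ville's inequality
bounds by `exp (-c)` the chance that the exponent, started at a given round, ever reaches `c`. A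
union over starting rounds alone costs a factor `L`; a union over all windows would cost `L ^ 2`
(`prob_exists_anchored_infix_le`).

The tilt `θ` should be scaled to the number of parties in the window. It may depend on the `n` of
the first round, since the plan is drawn before the queries, and the respecting condition compares
every other round with that one up to `γ`. The rest is deterministic: in good rounds targets are
bounded below, which bounds the cumulants, and the size of `ℓ` turns a deviation into an exponent of
at least the required level (`honest_exponent_of_deviation`, `total_exponent_of_deviation`,
`sumDH_gt_of_exponent_lt`).

Two points need care. For honest and adversarial queries together with `γ > 2`, the single scale `γ
n` is too coarse; a grid of about `2 γ` scales is used, each at level `4 λ / 3`, and `γ ≤ exp (λ /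
3)` pays for the union (`exists_tilts`). Windows longer than `s` are cut into pieces
(`of_real_pieces`); for the fraction `H` a piece can exceed `s` by less than one round, and its last
round is absorbed by slack (`sumDH_gt_append_singleton`). -/

/-- The mean of a nonnegative function under a probability mass function. -/
def mean {α : Type*} (μ : PMF α) (g : α → ENNReal) : ENNReal := ∑' a, μ a * g a

/-! ### Means and outer measures under probability mass functions. -/

section Mean

variable {α β : Type*}

lemma mean_pure (a : α) (g : α → ENNReal) : mean (PMF.pure a) g = g a := by
  classical
  unfold mean
  rw [tsum_eq_single a]
  · simp
  · intro b hb
    simp [PMF.pure_apply, hb]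

lemma mean_bind (μ : PMF α) (k : α → PMF β) (g : β → ENNReal) :
    mean (μ.bind k) g = mean μ fun a => mean (k a) g := by
  unfold mean
  simp only [PMF.bind_apply, ← ENNReal.tsum_mul_right, ← ENNReal.tsum_mul_left]
  rw [ENNReal.tsum_comm]
  simp only [mul_assoc]

lemma mean_map (μ : PMF α) (h : α → β) (g : β → ENNReal) :
    mean (μ.map h) g = mean μ (g ∘ h) := by
  rw [← PMF.bind_pure_comp, mean_bind]
  simp only [Function.comp_apply, mean_pure]
  rfl

lemma mean_mono (μ : PMF α) {g h : α → ENNReal} (hgh : ∀ a, g a ≤ h a) : mean μ g ≤ mean μ h :=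
  ENNReal.tsum_le_tsum fun a => mul_le_mul_right (hgh a) _

lemma mean_mul_right (μ : PMF α) (g : α → ENNReal) (c : ENNReal) :
    (mean μ fun a => g a * c) = mean μ g * c := by
  unfold mean
  simp only [← ENNReal.tsum_mul_right, mul_assoc]

lemma mean_const (μ : PMF α) (c : ENNReal) : (mean μ fun _ => c) = c := by
  unfold mean
  rw [ENNReal.tsum_mul_right, PMF.tsum_coe, one_mul]

lemma mean_le_of_forall_le (μ : PMF α) {g : α → ENNReal} {c : ENNReal} (h : ∀ a, g a ≤ c) :
    mean μ g ≤ c :=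
  (mean_mono μ h).trans (mean_const μ c).le

lemma toOuterMeasure_bind_eq_mean (μ : PMF α) (k : α → PMF β) (s : Set β) :
    (μ.bind k).toOuterMeasure s = mean μ fun a => (k a).toOuterMeasure s :=
  PMF.toOuterMeasure_bind_apply μ k s

lemma toOuterMeasure_le_one (μ : PMF α) (s : Set α) : μ.toOuterMeasure s ≤ 1 := by
  rw [PMF.toOuterMeasure_apply, ← μ.tsum_coe]
  exact ENNReal.tsum_le_tsum fun a => Set.indicator_le_self _ _ a

end Mean

variable {par : Params} {State : Type}

/-! ### The exponential supermartingale and its maximal inequality. -/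

/-- The cumulant bound `p T (exp (θ / T) - 1)` for the difficulty created by a query of target
`T`. -/
def cumulant (θ : ℝ) {κ : ℕ} (q : Query κ) : ℝ :=
  1 / 2 ^ κ * q.target * (Real.exp (θ / q.target) - 1)

lemma card_fruitRange {κ : ℕ} (q : Query κ) :
    (Finset.univ.filter fun y : Fin (2 ^ κ) =>
      q.blockTarget ≤ (y : ℕ) ∧ (y : ℕ) < q.blockTarget + q.target).card = q.target := by
  rw [← Finset.card_map Fin.valEmbedding]
  have : (Finset.univ.filter fun y : Fin (2 ^ κ) => q.blockTarget ≤ (y : ℕ) ∧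
      (y : ℕ) < q.blockTarget + q.target).map Fin.valEmbedding =
      Finset.Ico q.blockTarget (q.blockTarget + q.target) := by
    ext m
    simp only [Finset.mem_map, Finset.mem_filter, Finset.mem_univ, true_and,
      Fin.valEmbedding_apply, Finset.mem_Ico]
    constructor
    · rintro ⟨y, hy, rfl⟩
      exact hy
    · intro hm
      exact ⟨⟨m, hm.2.trans_le q.target_le⟩, hm, rfl⟩
  rw [this]
  simp

/-- Exactly `q.target` of the `2 ^ κ` replies give a fruit, so the moment generating function is `1
+ cumulant θ q`, and `1 + x ≤ exp x`. This holds for either sign of `θ`, hence serves both tails. -/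
lemma mean_uniform_exp_le_one (θ : ℝ) {κ : ℕ} (q : Query κ) :
    (mean (PMF.uniformOfFintype (Fin (2 ^ κ))) fun y =>
      ENNReal.ofReal (Real.exp (θ * fruitDifficulty q y - cumulant θ q))) ≤ 1 := by
  have h2 : (0 : ℝ) < 2 ^ κ := by positivity
  have hsum : ∑ y : Fin (2 ^ κ), Real.exp (θ * fruitDifficulty q y) =
      2 ^ κ + q.target * (Real.exp (θ / q.target) - 1) := by
    have : ∀ y : Fin (2 ^ κ), Real.exp (θ * fruitDifficulty q y) =
        1 + if q.blockTarget ≤ (y : ℕ) ∧ (y : ℕ) < q.blockTarget + q.target then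
          Real.exp (θ / q.target) - 1 else 0 := by
      intro y
      unfold fruitDifficulty
      split_ifs
      · rw [mul_one_div]; ring
      · simp
    simp only [this]
    rw [Finset.sum_add_distrib, ← Finset.sum_filter, Finset.sum_const, Finset.sum_const,
      card_fruitRange]
    simp
  have hcum : 1 / 2 ^ κ * (∑ y : Fin (2 ^ κ), Real.exp (θ * fruitDifficulty q y)) =
      1 + cumulant θ q := by
    rw [hsum, cumulant]
    field_simp
  unfold mean
  rw [tsum_fintype]
  have hterm : ∀ y : Fin (2 ^ κ), (PMF.uniformOfFintype (Fin (2 ^ κ))) y *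
      ENNReal.ofReal (Real.exp (θ * fruitDifficulty q y - cumulant θ q)) =
      ENNReal.ofReal (1 / 2 ^ κ * Real.exp (θ * fruitDifficulty q y) *
        Real.exp (-cumulant θ q)) := by
    intro y
    rw [PMF.uniformOfFintype_apply, sub_eq_add_neg, Real.exp_add, mul_assoc,
      ENNReal.ofReal_mul (by positivity : (0 : ℝ) ≤ 1 / 2 ^ κ), one_div,
      ENNReal.ofReal_inv_of_pos h2, ENNReal.ofReal_pow (by norm_num)]
    simp
  simp only [hterm]
  rw [← ENNReal.ofReal_sum_of_nonneg (fun _ _ => by positivity), ← Finset.sum_mul,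
    ← Finset.mul_sum, hcum, ← ENNReal.ofReal_one]
  apply ENNReal.ofReal_le_ofReal
  calc (1 + cumulant θ q) * Real.exp (-cumulant θ q)
      ≤ Real.exp (cumulant θ q) * Real.exp (-cumulant θ q) := by
        gcongr
        linarith [Real.add_one_le_exp (cumulant θ q)]
    _ = 1 := by rw [← Real.exp_add]; simp

open Classical in
/-- The compensated exponent of the queries that the parties in `A` make. -/
def logExponent {P : RoundPlan par} (A : Set P.Party) (θ : ℝ) (log : List (QueryRecord P)) : ℝ :=
  (log.map fun e => if e.party ∈ A then
    θ * fruitDifficulty e.query e.reply - cumulant θ e.query else 0).sum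

/-- The compensated exponent of a list of rounds: its exponential is a supermartingale. -/
def exponent (A : (P : RoundPlan par) → Set P.Party) (θ : ℝ) (S : List (RoundRecord par)) : ℝ :=
  (S.map fun R => logExponent (A R.plan) θ R.log).sum

/-- One supermartingale step: once the reply is known its contribution is a constant factor, the
later queries contribute mean at most 1, and averaging over the reply gives at most 1 again. -/
lemma mean_reply_le_one {P : RoundPlan par} (A : Set P.Party) (θ : ℝ) (a : P.Party)
    (q : Query par.κ) (law : Fin (2 ^ par.κ) → PMF (List (QueryRecord P) × State))
    (hlaw : ∀ y, (mean (law y) fun res =>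
      ENNReal.ofReal (Real.exp (logExponent A θ res.1))) ≤ 1) :
    (mean ((PMF.uniformOfFintype (Fin (2 ^ par.κ))).bind fun y =>
        (law y).map fun res => ((⟨a, q, y⟩ :: res.1 : List (QueryRecord P)), res.2))
      fun res => ENNReal.ofReal (Real.exp (logExponent A θ res.1))) ≤ 1 := by
  classical
  rw [mean_bind]
  calc _ ≤ mean (PMF.uniformOfFintype (Fin (2 ^ par.κ))) fun y => ENNReal.ofReal (Real.exp
        (if a ∈ A then θ * fruitDifficulty q y - cumulant θ q else 0)) := by
        refine mean_mono _ fun y => ?_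
        rw [mean_map]
        have : ((fun res : List (QueryRecord P) × State =>
            ENNReal.ofReal (Real.exp (logExponent A θ res.1))) ∘
            fun res : List (QueryRecord P) × State =>
              ((⟨a, q, y⟩ :: res.1 : List (QueryRecord P)), res.2)) =
            fun res : List (QueryRecord P) × State =>
              ENNReal.ofReal (Real.exp (logExponent A θ res.1)) * ENNReal.ofReal (Real.exp
              (if a ∈ A then θ * fruitDifficulty q y - cumulant θ q else 0)) := by
          funext res
          rw [← ENNReal.ofReal_mul (by positivity), ← Real.exp_add, add_comm]
          simp [logExponent]
        rw [this, mean_mul_right]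
        exact mul_le_of_le_one_left' (hlaw y)
    _ ≤ 1 := by
        by_cases ha : a ∈ A
        · simpa only [ha, if_true] using mean_uniform_exp_le_one θ q
        · simp [ha, mean_const]

lemma mean_runQueries_le_one (sys : System par State) (P : RoundPlan par) (A : Set P.Party)
    (θ : ℝ) (as : List P.Party) (x : State) :
    (mean (sys.runQueries P as x) fun res =>
      ENNReal.ofReal (Real.exp (logExponent A θ res.1))) ≤ 1 := by
  induction as generalizing x with
  | nil => simp [System.runQueries, mean_pure, logExponent]
  | cons a as ih =>
    rcases a with i | j
    · rw [System.runQueries, mean_bind]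
      exact mean_le_of_forall_le _ fun qx => mean_reply_le_one A θ _ _ _ fun y => ih _
    · rw [System.runQueries, mean_bind]
      refine mean_le_of_forall_le _ fun qx => ?_
      rcases qx with ⟨_ | q, x'⟩
      · exact ih _
      · exact mean_reply_le_one A θ _ _ _ fun y => ih _

lemma mean_runRound_le_one (sys : System par State) (A : (P : RoundPlan par) → Set P.Party)
    (θ : ℝ) (x : State) :
    (mean (sys.runRound x) fun res =>
      ENNReal.ofReal (Real.exp (logExponent (A res.1.plan) θ res.1.log))) ≤ 1 := by
  rw [System.runRound, mean_bind]
  refine mean_le_of_forall_le _ fun Px => ?_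
  rw [mean_map]
  exact mean_runQueries_le_one sys Px.1 (A Px.1) θ _ _

lemma exponent_cons (A : (P : RoundPlan par) → Set P.Party) (θ : ℝ) (R : RoundRecord par)
    (S : List (RoundRecord par)) :
    exponent A θ (R :: S) = logExponent (A R.plan) θ R.log + exponent A θ S := by
  simp [exponent]

/-- Ville's maximal inequality for the exponential supermartingale. -/
lemma prob_exists_prefix_le (sys : System par State) (A : (P : RoundPlan par) → Set P.Party)
    (θ c : ℝ) (L : ℕ) (x : State) :
    (sys.runRounds L x).toOuterMeasure {E | ∃ S, S <+: E ∧ c ≤ exponent A θ S} ≤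
      ENNReal.ofReal (Real.exp (-c)) := by
  induction L generalizing x c with
  | zero =>
    by_cases hc : c ≤ 0
    · refine (toOuterMeasure_le_one _ _).trans ?_
      rw [ENNReal.one_le_ofReal]
      exact Real.one_le_exp (by linarith)
    · rw [System.runRounds, PMF.toOuterMeasure_pure_apply, if_neg]
      · exact zero_le
      · rintro ⟨S, hS, h⟩
        rw [List.prefix_nil] at hS
        subst hS
        exact hc (by simpa [exponent] using h)
  | succ L ih =>
    by_cases hc : c ≤ 0
    · refine (toOuterMeasure_le_one _ _).trans ?_
      rw [ENNReal.one_le_ofReal]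
      exact Real.one_le_exp (by linarith)
    -- With `c > 0` the empty prefix does not reach the level, so the prefix contains the first
    -- round and the later rounds must reach what remains of `c`.
    rw [System.runRounds, toOuterMeasure_bind_eq_mean]
    calc _ ≤ mean (sys.runRound x) fun res => ENNReal.ofReal
            (Real.exp (logExponent (A res.1.plan) θ res.1.log)) *
            ENNReal.ofReal (Real.exp (-c)) := by
          refine mean_mono _ fun res => ?_
          rw [PMF.toOuterMeasure_map_apply, ← ENNReal.ofReal_mul (by positivity), ← Real.exp_add]
          refine le_trans (MeasureTheory.measure_mono ?_)
            ((ih (c - logExponent (A res.1.plan) θ res.1.log) res.2).trans_eq (by ring_nf))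
          rintro rest ⟨S, hS, h⟩
          rcases S with _ | ⟨R, S⟩
          · exact absurd (by simpa [exponent] using h) hc
          · obtain ⟨rfl, hS'⟩ := List.cons_prefix_cons.1 hS
            rw [exponent_cons] at h
            exact ⟨S, hS', by linarith⟩
      _ ≤ ENNReal.ofReal (Real.exp (-c)) := by
          rw [mean_mul_right]
          exact mul_le_of_le_one_left' (mean_runRound_le_one sys A θ x)

/-- The maximal inequality when the exponent depends on the number of parties in the first round. -/
lemma prob_exists_anchored_prefix_le (sys : System par State)
    (A : (P : RoundPlan par) → Set P.Party) (θ : ℕ → ℝ) (c : ℝ) (L : ℕ) (x : State) :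
    (sys.runRounds L x).toOuterMeasure
        {E | ∃ R S, R :: S <+: E ∧ c ≤ exponent A (θ R.plan.n) (R :: S)} ≤
      ENNReal.ofReal (Real.exp (-c)) := by
  rcases L with _ | L
  · rw [System.runRounds, PMF.toOuterMeasure_pure_apply, if_neg]
    · exact zero_le
    · rintro ⟨R, S, hS, -⟩
      simp at hS
  rw [System.runRounds, toOuterMeasure_bind_eq_mean, System.runRound, mean_bind]
  -- Conditioning on the plan fixes `n`, hence `θ`, before any reply is drawn.
  refine mean_le_of_forall_le _ fun Px => ?_
  rw [mean_map]
  calc _ ≤ mean (sys.runQueries Px.1 (List.ofFn Px.1.order) Px.2) fun res => ENNReal.ofReal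
          (Real.exp (logExponent (A Px.1) (θ Px.1.n) res.1)) *
          ENNReal.ofReal (Real.exp (-c)) := by
        refine mean_mono _ fun res => ?_
        rw [Function.comp_apply, PMF.toOuterMeasure_map_apply,
          ← ENNReal.ofReal_mul (by positivity), ← Real.exp_add]
        refine le_trans (MeasureTheory.measure_mono ?_)
          ((prob_exists_prefix_le sys A (θ Px.1.n)
            (c - logExponent (A Px.1) (θ Px.1.n) res.1) L res.2).trans_eq (by ring_nf))
        rintro rest ⟨R, S, hS, h⟩
        obtain ⟨rfl, hS'⟩ := List.cons_prefix_cons.1 hS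
        rw [exponent_cons] at h
        exact ⟨S, hS', by linarith⟩
    _ ≤ ENNReal.ofReal (Real.exp (-c)) := by
        rw [mean_mul_right]
        exact mul_le_of_le_one_left' (mean_runQueries_le_one sys Px.1 _ _ _ _)

lemma prob_runRounds_exists_anchored_infix_le (sys : System par State)
    (A : (P : RoundPlan par) → Set P.Party) (θ : ℕ → ℝ) (c : ℝ) (L : ℕ) (x : State) :
    (sys.runRounds L x).toOuterMeasure
        {E | ∃ R S, R :: S <:+: E ∧ c ≤ exponent A (θ R.plan.n) (R :: S)} ≤
      L * ENNReal.ofReal (Real.exp (-c)) := by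
  induction L generalizing x with
  | zero =>
    rw [System.runRounds, PMF.toOuterMeasure_pure_apply, if_neg]
    · exact zero_le
    · rintro ⟨R, S, hS, -⟩
      simp at hS
  | succ L ih =>
    calc _ ≤ (sys.runRounds (L + 1) x).toOuterMeasure
          ({E | ∃ R S, R :: S <+: E ∧ c ≤ exponent A (θ R.plan.n) (R :: S)} ∪
            {E | ∃ R S, R :: S <:+: E.tail ∧ c ≤ exponent A (θ R.plan.n) (R :: S)}) := by
          refine MeasureTheory.measure_mono ?_
          rintro E ⟨R, S, hS, h⟩
          rcases E with _ | ⟨R', E⟩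
          · simp at hS
          · rcases List.infix_cons_iff.1 hS with hS | hS
            · exact Or.inl ⟨R, S, hS, h⟩
            · exact Or.inr ⟨R, S, hS, h⟩
      _ ≤ ENNReal.ofReal (Real.exp (-c)) + L * ENNReal.ofReal (Real.exp (-c)) := by
          refine (MeasureTheory.measure_union_le _ _).trans (add_le_add
            (prob_exists_anchored_prefix_le sys A θ c (L + 1) x) ?_)
          rw [System.runRounds, toOuterMeasure_bind_eq_mean]
          refine mean_le_of_forall_le _ fun res => ?_
          rw [PMF.toOuterMeasure_map_apply]
          exact ih res.2
      _ = _ := by push_cast; ring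

/-- A union bound over the first round of the set of rounds. -/
lemma prob_exists_anchored_infix_le (sys : System par State)
    (A : (P : RoundPlan par) → Set P.Party) (θ : ℕ → ℝ) (c : ℝ) (L : ℕ) :
    (sys.execution L).toOuterMeasure
        {E | ∃ R S, R :: S <:+: E ∧ c ≤ exponent A (θ R.plan.n) (R :: S)} ≤
      L * ENNReal.ofReal (Real.exp (-c)) := by
  rw [System.execution, toOuterMeasure_bind_eq_mean]
  exact mean_le_of_forall_le _ fun x => prob_runRounds_exists_anchored_infix_le sys A θ c L x

/-! ### Bookkeeping: numbers of honest queries and of rounds. -/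

/-- In the record each honest party of the round occurs as in the order of activation. -/
lemma countP_party_of_mem_support_runQueries (sys : System par State) (P : RoundPlan par)
    (pr : P.Party → Bool) (hpr : ∀ j, pr (Sum.inr j) = false) (as : List P.Party) (x : State)
    (res : List (QueryRecord P) × State) (h : res ∈ (sys.runQueries P as x).support) :
    (res.1.countP fun e => pr e.party) = as.countP pr := by
  induction as generalizing x res with
  | nil =>
    rw [System.runQueries, PMF.mem_support_pure_iff] at h
    simp [h]
  | cons a as ih =>
    rcases a with i | j
    · simp only [System.runQueries, PMF.mem_support_bind_iff, PMF.mem_support_map_iff] at h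
      obtain ⟨qx, -, y, -, res', h', rfl⟩ := h
      simp only [List.countP_cons, ih _ _ h']
    · simp only [System.runQueries, PMF.mem_support_bind_iff] at h
      obtain ⟨⟨_ | q, x'⟩, -, h⟩ := h
      · rw [ih _ _ h, List.countP_cons, hpr]
        simp
      · simp only [PMF.mem_support_bind_iff, PMF.mem_support_map_iff] at h
        obtain ⟨y, -, res', h', rfl⟩ := h
        simp only [List.countP_cons, ih _ _ h', hpr]

lemma countP_ofFn_order (P : RoundPlan par) (pr : P.Party → Bool) :
    (List.ofFn P.order).countP pr = (Finset.univ.filter fun a : P.Party => pr a = true).card := by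
  classical
  rw [List.countP_eq_length_filter,
    ← List.toFinset_card_of_nodup ((List.nodup_ofFn.2 P.order.injective).filter _)]
  congr 1
  ext a
  simp only [List.mem_toFinset, List.mem_filter, List.mem_ofFn, Finset.mem_filter,
    Finset.mem_univ, true_and]
  exact and_iff_right ⟨P.order.symm a, by simp⟩

/-- Each honest party makes exactly one query in the round. -/
structure RoundRecord.Complete (R : RoundRecord par) : Prop where
  honest : (R.log.countP fun e => e.party.isLeft) = R.plan.n
  fraction : (R.log.countP fun e => e.party.elim (fun i => decide (i ∈ R.plan.H)) fun _ => false) =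
    R.plan.H.card

lemma complete_of_mem_support_runRound (sys : System par State) (x : State)
    (res : RoundRecord par × State) (h : res ∈ (sys.runRound x).support) : res.1.Complete := by
  classical
  simp only [System.runRound, PMF.mem_support_bind_iff, PMF.mem_support_map_iff] at h
  obtain ⟨Px, -, res', h', rfl⟩ := h
  constructor
  · refine (countP_party_of_mem_support_runQueries sys Px.1 Sum.isLeft (fun _ => rfl) _ _ _
      h').trans ?_
    rw [countP_ofFn_order]
    trans (Finset.univ.map (Function.Embedding.inl : Fin Px.1.n ↪ Px.1.Party)).card
    · congr 1
      ext (i | j) <;> simp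
    · simp
  · refine (countP_party_of_mem_support_runQueries sys Px.1
      (Sum.elim (fun i => decide (i ∈ Px.1.H)) fun _ => false) (fun _ => rfl) _ _ _ h').trans ?_
    rw [countP_ofFn_order]
    trans (Px.1.H.map (Function.Embedding.inl : Fin Px.1.n ↪ Px.1.Party)).card
    · congr 1
      ext (i | j) <;> simp
    · simp

lemma of_mem_support_runRounds (sys : System par State) (L : ℕ) (x : State)
    (E : List (RoundRecord par)) (h : E ∈ (sys.runRounds L x).support) :
    E.length = L ∧ ∀ R ∈ E, R.Complete := by
  induction L generalizing x E with
  | zero =>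
    rw [System.runRounds, PMF.mem_support_pure_iff] at h
    simp [h]
  | succ L ih =>
    simp only [System.runRounds, PMF.mem_support_bind_iff, PMF.mem_support_map_iff] at h
    obtain ⟨res, hres, rest, hrest, rfl⟩ := h
    obtain ⟨hl, hc⟩ := ih _ _ hrest
    refine ⟨by simp [hl], ?_⟩
    simp only [List.mem_cons, forall_eq_or_imp]
    exact ⟨complete_of_mem_support_runRound sys x res hres, hc⟩

lemma of_mem_support_execution (sys : System par State) (L : ℕ) (E : List (RoundRecord par))
    (h : E ∈ (sys.execution L).support) : E.length = L ∧ ∀ R ∈ E, R.Complete := by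
  rw [System.execution, PMF.mem_support_bind_iff] at h
  obtain ⟨x, -, h⟩ := h
  exact of_mem_support_runRounds sys L x E h

/-! ### Bounds on the cumulant. -/

section Cumulant

lemma exp_sub_one_le {x : ℝ} (h0 : 0 ≤ x) (h1 : x ≤ 1) :
    Real.exp x - 1 ≤ x * (1 + x / 2 + x ^ 2 / 4) := by
  have h := Real.exp_bound' h0 h1 (n := 3) (by norm_num)
  simp only [Finset.sum_range_succ, Finset.sum_range_zero, Nat.factorial] at h
  norm_num at h
  nlinarith [pow_nonneg h0 3]

lemma exp_neg_sub_one_le {x : ℝ} (h0 : 0 ≤ x) : Real.exp (-x) - 1 ≤ -(x * (1 - x / 2)) := by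
  have h := Real.quadratic_le_exp_of_nonneg h0
  have hpos : 0 < 1 + x + x ^ 2 / 2 := by positivity
  have h1 : Real.exp (-x) ≤ 1 / (1 + x + x ^ 2 / 2) := by
    rw [Real.exp_neg, ← one_div]
    exact one_div_le_one_div_of_le hpos h
  have h2 : 1 / (1 + x + x ^ 2 / 2) ≤ 1 - x + x ^ 2 / 2 := by
    rw [div_le_iff₀ hpos]
    -- The product `(1 + x + x ^ 2 / 2) (1 - x + x ^ 2 / 2)` equals `1 + x ^ 4 / 4`.
    nlinarith [sq_nonneg (x ^ 2)]
  linarith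

lemma p_pos (par : Params) : 0 < par.p := by
  unfold Params.p
  positivity

/-- The target cancels from the leading term `p θ`; only the correction depends on it, through a
bound `v` on `θ / T`. This is why lower bounds on targets suffice. -/
lemma cumulant_le {θ v : ℝ} (q : Query par.κ) (h0 : 0 ≤ θ) (hv : θ ≤ v * q.target) (h1 : v ≤ 1) :
    cumulant θ q ≤ par.p * θ * (1 + v / 2 + v ^ 2 / 4) := by
  have hT : (0 : ℝ) < q.target := by exact_mod_cast q.target_pos
  have hx : θ / q.target ≤ v := by rwa [div_le_iff₀ hT]
  have hx0 : 0 ≤ θ / q.target := by positivity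
  have hp := p_pos par
  have h := exp_sub_one_le hx0 (hx.trans h1)
  calc cumulant θ q = par.p * (q.target * (Real.exp (θ / q.target) - 1)) := by
        unfold cumulant Params.p; ring
    _ ≤ par.p * (q.target * (θ / q.target * (1 + v / 2 + v ^ 2 / 4))) := by
        gcongr
        refine h.trans ?_
        gcongr
    _ = par.p * θ * (1 + v / 2 + v ^ 2 / 4) := by
        field_simp

lemma cumulant_neg_le {θ v : ℝ} (q : Query par.κ) (h0 : 0 ≤ θ) (hv : θ ≤ v * q.target) :
    cumulant (-θ) q ≤ -(par.p * θ * (1 - v / 2)) := by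
  have hT : (0 : ℝ) < q.target := by exact_mod_cast q.target_pos
  have hx : θ / q.target ≤ v := by rwa [div_le_iff₀ hT]
  have hx0 : 0 ≤ θ / q.target := by positivity
  have hp := p_pos par
  have h := exp_neg_sub_one_le hx0
  calc cumulant (-θ) q = par.p * (q.target * (Real.exp (-(θ / q.target)) - 1)) := by
        unfold cumulant Params.p; rw [neg_div]; ring
    _ ≤ par.p * (q.target * (-(θ / q.target * (1 - v / 2)))) := by
        gcongr
        refine h.trans (neg_le_neg ?_)
        gcongr
    _ = -(par.p * θ * (1 - v / 2)) := by
        field_simp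

end Cumulant

/-! ### From exponents to difficulties and numbers of queries. -/

section Sums

/-- The honest parties. -/
def honestParties (P : RoundPlan par) : Set P.Party := {a | a.isLeft}

/-- The honest parties in the given fraction. -/
def fractionParties (P : RoundPlan par) : Set P.Party := {a | ∃ i ∈ P.H, a = Sum.inl i}

-- A uniform bound on the cumulants replaces the random compensator by a multiple of the number of
-- queries.
open Classical in
lemma logExponent_ge (R : RoundRecord par) (A : Set R.plan.Party) (θ k : ℝ)
    (h : ∀ e ∈ R.log, e.party ∈ A → cumulant θ e.query ≤ k) :
    θ * R.difficulty A - k * (R.log.countP fun e => decide (e.party ∈ A) : ℕ) ≤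
      logExponent A θ R.log := by
  unfold RoundRecord.difficulty logExponent
  generalize R.log = log at h
  induction log with
  | nil => simp
  | cons e log ih =>
    simp only [List.mem_cons, forall_eq_or_imp] at h
    have := ih h.2
    simp only [List.map_cons, List.sum_cons, List.countP_cons]
    by_cases he : e.party ∈ A
    · have := h.1 he
      simp only [he, if_true, decide_true]
      push_cast
      linarith
    · simp only [he, if_false, decide_false]
      simpa using this

lemma logExponent_honest_ge (R : RoundRecord par) (hR : R.Complete) (θ k : ℝ)
    (h : ∀ e ∈ R.log, e.party.isLeft → cumulant θ e.query ≤ k) :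
    θ * R.D - k * R.plan.n ≤ logExponent (honestParties R.plan) θ R.log := by
  refine le_trans (le_of_eq ?_) (logExponent_ge R (honestParties R.plan) θ k h)
  rw [← hR.honest]
  congr 3
  refine List.countP_congr fun e _ => ?_
  rcases e with ⟨i | j, q, y⟩ <;> simp [honestParties]

lemma logExponent_fraction_ge (R : RoundRecord par) (hR : R.Complete) (θ k : ℝ)
    (h : ∀ e ∈ R.log, e.party.isLeft → cumulant θ e.query ≤ k) :
    θ * R.DH - k * R.plan.H.card ≤ logExponent (fractionParties R.plan) θ R.log := by
  classical
  refine le_trans (le_of_eq ?_) (logExponent_ge R (fractionParties R.plan) θ k ?_)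
  · rw [← hR.fraction]
    congr 3
    refine List.countP_congr fun e _ => ?_
    rcases e with ⟨i | j, q, y⟩ <;> simp [fractionParties]
  · rintro e he ⟨i, -, hi⟩
    exact h e he (by simp [hi])

lemma logExponent_total_ge (R : RoundRecord par) (hR : R.Complete) (θ k k' : ℝ)
    (h : ∀ e ∈ R.log, e.party.isLeft → cumulant θ e.query ≤ k)
    (h' : ∀ e ∈ R.log, e.party.isRight → cumulant θ e.query ≤ k') :
    θ * (R.D + R.A) - (k * R.plan.n + k' * R.numAdv) ≤ logExponent Set.univ θ R.log := by
  have h1 := logExponent_honest_ge R hR θ k h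
  have h2 := logExponent_ge R {a | a.isRight} θ k' h'
  have h3 : logExponent Set.univ θ R.log = logExponent (honestParties R.plan) θ R.log +
      logExponent {a | a.isRight} θ R.log := by
    unfold logExponent
    rw [← List.sum_map_add]
    congr 1
    refine List.map_congr_left fun e _ => ?_
    rcases e with ⟨i | j, q, y⟩ <;> simp [honestParties]
  have h4 : θ * R.A - k' * R.numAdv ≤ logExponent {a | a.isRight} θ R.log := by
    refine le_trans (le_of_eq ?_) h2
    unfold RoundRecord.A RoundRecord.numAdv
    congr 3
    refine List.countP_congr fun e _ => ?_
    simp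
  rw [h3]
  linarith

variable {S : List (RoundRecord par)}

lemma exponent_honest_ge (hS : ∀ R ∈ S, R.Complete) (θ k : ℝ)
    (h : ∀ R ∈ S, ∀ e ∈ R.log, e.party.isLeft → cumulant θ e.query ≤ k) :
    θ * sumD S - k * sumN S ≤ exponent honestParties θ S := by
  induction S with
  | nil => simp [sumD, sumN, exponent]
  | cons R S ih =>
    simp only [List.mem_cons, forall_eq_or_imp] at hS h
    have h1 := ih hS.2 h.2
    have h2 := logExponent_honest_ge R hS.1 θ k h.1
    rw [exponent_cons]
    simp only [sumD, sumN, List.map_cons, List.sum_cons] at h1 ⊢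
    linarith

lemma exponent_fraction_ge (hS : ∀ R ∈ S, R.Complete) (θ k : ℝ)
    (h : ∀ R ∈ S, ∀ e ∈ R.log, e.party.isLeft → cumulant θ e.query ≤ k) :
    θ * sumDH S - k * sumNH S ≤ exponent fractionParties θ S := by
  induction S with
  | nil => simp [sumDH, sumNH, exponent]
  | cons R S ih =>
    simp only [List.mem_cons, forall_eq_or_imp] at hS h
    have h1 := ih hS.2 h.2
    have h2 := logExponent_fraction_ge R hS.1 θ k h.1
    rw [exponent_cons]
    simp only [sumDH, sumNH, List.map_cons, List.sum_cons] at h1 ⊢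
    linarith

lemma exponent_total_ge (hS : ∀ R ∈ S, R.Complete) (θ k k' : ℝ)
    (h : ∀ R ∈ S, ∀ e ∈ R.log, e.party.isLeft → cumulant θ e.query ≤ k)
    (h' : ∀ R ∈ S, ∀ e ∈ R.log, e.party.isRight → cumulant θ e.query ≤ k') :
    θ * (sumD S + sumA S) - (k * sumN S + k' * sumJ S) ≤
      exponent (fun _ => Set.univ) θ S := by
  induction S with
  | nil => simp [sumD, sumA, sumN, sumJ, exponent]
  | cons R S ih =>
    simp only [List.mem_cons, forall_eq_or_imp] at hS h h'
    have h1 := ih hS.2 h.2 h'.2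
    have h2 := logExponent_total_ge R hS.1 θ k k' h.1 h'.1
    rw [exponent_cons]
    simp only [sumD, sumA, sumN, sumJ, List.map_cons, List.sum_cons] at h1 ⊢
    linarith

lemma length_mul_le_sumN {μ : ℝ} (h : ∀ R ∈ S, μ ≤ R.plan.n) : S.length * μ ≤ sumN S := by
  have := List.card_nsmul_le_sum (S.map fun R => (R.plan.n : ℝ)) μ (by simpa using h)
  simpa [sumN] using this

lemma length_mul_le_sumNH {μ : ℝ} (h : ∀ R ∈ S, μ ≤ R.plan.H.card) : S.length * μ ≤ sumNH S := by
  have := List.card_nsmul_le_sum (S.map fun R => (R.plan.H.card : ℝ)) μ (by simpa using h)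
  simpa [sumNH] using this

lemma difficulty_nonneg (R : RoundRecord par) (A : Set R.plan.Party) : 0 ≤ R.difficulty A := by
  unfold RoundRecord.difficulty
  refine List.sum_nonneg fun x hx => ?_
  obtain ⟨e, -, rfl⟩ := List.mem_map.1 hx
  unfold fruitDifficulty
  split_ifs <;> positivity

end Sums

/-! ### Consequences of the choice of `ℓ`. -/

section Parameters

lemma Params.Valid.ell_ge (hpar : par.Valid) :
    4 * (1 + 3 * par.ε) * par.τ * par.γ ^ 4 * par.lam ≤ par.ε ^ 2 * par.f * par.ell := by
  have hε := hpar.ε_pos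
  have hf := hpar.f_pos
  have hγ := hpar.one_le_γ
  have hlam := hpar.lam_pos
  have hδ := hpar.δ_pos
  have hτ := hpar.one_le_τ
  have hB0 : 0 < 1 - (1 + par.δ) * par.γ ^ 2 * par.f := by linarith [hpar.rate_lt_one]
  have hB1 : 1 - (1 + par.δ) * par.γ ^ 2 * par.f ≤ 1 := by
    have : 0 ≤ (1 + par.δ) * par.γ ^ 2 * par.f := by positivity
    linarith
  have hpow := pow_le_one₀ hB0.le hB1 (n := par.Δ + 1)
  have hpow0 := pow_pos hB0 (par.Δ + 1)
  set B := (1 - (1 + par.δ) * par.γ ^ 2 * par.f) ^ (par.Δ + 1) with hB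
  have h : par.ε ^ 2 * par.f * par.ell =
      4 * (1 + 3 * par.ε) * max (par.Δ : ℝ) par.τ * par.γ ^ 4 * par.lam / B := by
    unfold Params.ell
    rw [← hB]
    field_simp
  rw [h, le_div_iff₀ hpow0]
  have hmax : par.τ ≤ max (par.Δ : ℝ) par.τ := le_max_right _ _
  calc 4 * (1 + 3 * par.ε) * par.τ * par.γ ^ 4 * par.lam * B
      ≤ 4 * (1 + 3 * par.ε) * par.τ * par.γ ^ 4 * par.lam * 1 := by gcongr
    _ ≤ 4 * (1 + 3 * par.ε) * max (par.Δ : ℝ) par.τ * par.γ ^ 4 * par.lam := by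
        rw [mul_one]; gcongr

lemma Params.Valid.ell_pos (hpar : par.Valid) : 0 < par.ell := by
  have hε := hpar.ε_pos
  have hf := hpar.f_pos
  have hγ := hpar.one_le_γ
  have hlam := hpar.lam_pos
  have hτ := hpar.one_le_τ
  have h := hpar.ell_ge
  have h1 : 0 < 4 * (1 + 3 * par.ε) * par.τ * par.γ ^ 4 * par.lam := by positivity
  exact pos_of_mul_pos_right (h1.trans_le h) (by positivity)

/-- The factor `f` in `ell_ge` is traded for `γ ^ 2` by means of `γ ^ 2 f ≤ 1`. The result makes `ℓ`
large compared with powers of `γ`. -/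
lemma Params.Valid.ell_ge_pow (hpar : par.Valid) :
    4 * par.γ ^ 6 * par.lam ≤ par.ε ^ 2 * par.ell := by
  have hε := hpar.ε_pos
  have hf := hpar.f_pos
  have hγ := hpar.one_le_γ
  have hlam := hpar.lam_pos
  have hτ := hpar.one_le_τ
  have hδ := hpar.δ_pos
  have hell := hpar.ell_pos
  have h1 : par.γ ^ 2 * par.f ≤ 1 := by
    have := hpar.rate_lt_one
    have : 0 ≤ par.δ * (par.γ ^ 2 * par.f) := by positivity
    linarith
  calc 4 * par.γ ^ 6 * par.lam = par.γ ^ 2 * (4 * (1 + 3 * 0) * 1 * par.γ ^ 4 * par.lam) := by ring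
    _ ≤ par.γ ^ 2 * (4 * (1 + 3 * par.ε) * par.τ * par.γ ^ 4 * par.lam) := by gcongr
    _ ≤ par.γ ^ 2 * (par.ε ^ 2 * par.f * par.ell) :=
        mul_le_mul_of_nonneg_left hpar.ell_ge (by positivity)
    _ = par.γ ^ 2 * par.f * (par.ε ^ 2 * par.ell) := by ring
    _ ≤ 1 * (par.ε ^ 2 * par.ell) := by gcongr
    _ = _ := one_mul _

lemma Params.Valid.pow_mul_lam_le_ell (hpar : par.Valid) : 4 * par.γ ^ 6 * par.lam ≤ par.ell := by
  have hε := hpar.ε_pos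
  have hell := hpar.ell_pos
  refine hpar.ell_ge_pow.trans ?_
  have : par.ε ^ 2 ≤ 1 := pow_le_one₀ hε.le hpar.ε_lt_one.le
  nlinarith

lemma Params.Valid.fraction_pos (hpar : par.Valid) : 0 < par.φ * (2 - par.δ) :=
  mul_pos hpar.φ_pos (by linarith [hpar.δ_lt_one])

lemma Params.Valid.ell_le_ellFraction (hpar : par.Valid) : par.ell ≤ par.ellFraction := by
  have h := hpar.φ_lt
  rw [lt_div_iff₀ (by linarith [hpar.δ_lt_one])] at h
  exact le_div_self hpar.ell_pos.le hpar.fraction_pos h.le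

/-- The tilting parameter, up to scale, for the upper tails. -/
def Params.tilt (par : Params) : ℝ := par.ε / (1 + par.ε)

lemma Params.Valid.tilt_pos (hpar : par.Valid) : 0 < par.tilt :=
  div_pos hpar.ε_pos (by linarith [hpar.ε_pos])

lemma Params.Valid.tilt_le (hpar : par.Valid) : par.tilt ≤ 1 / 2 := by
  have := hpar.ε_pos
  have := hpar.ε_lt_one
  unfold Params.tilt
  rw [div_le_iff₀ (by linarith)]
  linarith

lemma Params.Valid.tilt_mul (hpar : par.Valid) : par.tilt * (1 + par.ε) = par.ε := by
  have := hpar.ε_pos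
  unfold Params.tilt
  field_simp

/-- With `z = ε / (1 + ε)`, the identity `ε = z + z ε` turns the gain per query into `z (1 / 2 + ε -
z / 4)`, and `ε = z (1 + ε)` reduces the claim to a polynomial inequality. The factor `1 + 3 ε` in
`ℓ` is what this needs. -/
lemma Params.Valid.sq_le_tilt (hpar : par.Valid) : par.ε ^ 2 ≤ 2 * (1 + 3 * par.ε) *
    (par.tilt * (1 + par.ε - (1 + par.tilt / 2 + par.tilt ^ 2 / 4))) := by
  have hε := hpar.ε_pos
  have hz := hpar.tilt_pos
  have hz2 := hpar.tilt_le
  have hmul := hpar.tilt_mul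
  have h1 : par.ε = par.tilt + par.tilt * par.ε := by linarith
  have h2 : 1 + par.ε - (1 + par.tilt / 2 + par.tilt ^ 2 / 4) =
      par.tilt * (1 / 2 + par.ε - par.tilt / 4) := by
    linear_combination -hmul
  rw [h2]
  nth_rewrite 1 [← hmul]
  have h3 : par.tilt ≤ par.ε := by nlinarith
  have h4 : (1 + par.ε) ^ 2 ≤ 2 * (1 + 3 * par.ε) * (1 / 2 + par.ε - par.tilt / 4) := by
    nlinarith
  nlinarith [mul_le_mul_of_nonneg_left h4 (sq_nonneg par.tilt)]

lemma Params.Valid.rate_ge (hpar : par.Valid) {l : ℝ} (hl : par.ell ≤ l) :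
    2 * (par.lam * par.τ * par.γ ^ 4) ≤ l * par.f *
      (par.tilt * (1 + par.ε - (1 + par.tilt / 2 + par.tilt ^ 2 / 4))) := by
  have hε := hpar.ε_pos
  have hf := hpar.f_pos
  have hell := hpar.ell_pos
  have h1 := hpar.ell_ge
  have h2 := hpar.sq_le_tilt
  set w := par.tilt * (1 + par.ε - (1 + par.tilt / 2 + par.tilt ^ 2 / 4))
  have hw : 0 < w := by
    have : 0 < par.ε ^ 2 := by positivity
    exact pos_of_mul_pos_right (this.trans_le h2) (by positivity)
  refine le_of_mul_le_mul_left ?_ (by positivity : 0 < 2 * (1 + 3 * par.ε))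
  calc 2 * (1 + 3 * par.ε) * (2 * (par.lam * par.τ * par.γ ^ 4))
      = 4 * (1 + 3 * par.ε) * par.τ * par.γ ^ 4 * par.lam := by ring
    _ ≤ par.ε ^ 2 * par.f * par.ell := h1
    _ ≤ (2 * (1 + 3 * par.ε) * w) * par.f * l := by gcongr
    _ = _ := by ring

end Parameters

/-! ### A deviation forces a large exponent. -/

section Deviations

variable {S : List (RoundRecord par)}

/-- Goodness and `n ≤ m` give `θ / T ≤ tilt`, so an honest query costs at most `p θ (1 + z / 2 + z ^
2 / 4)` with `z = tilt`, while the deviation pays `p θ (1 + ε)`. The surplus accumulates over at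
least `ℓ` rounds of at least `μ` queries each. -/
lemma honest_exponent_of_deviation (hpar : par.Valid) (hS : ∀ R ∈ S, R.Complete)
    (hgood : ∀ R ∈ S, R.Good) (hl : par.ell ≤ S.length) {m μ : ℝ} (hm0 : 0 < m) (hμ0 : 0 < μ)
    (hm : ∀ R ∈ S, (R.plan.n : ℝ) ≤ m) (hμ : ∀ R ∈ S, μ ≤ R.plan.n)
    (hdev : (1 + par.ε) * par.p * sumN S ≤ sumD S) :
    par.γ ^ 2 * (μ / m) * par.lam ≤
      exponent honestParties (par.tilt * par.f / (2 * par.γ ^ 2 * par.p * m)) S := by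
  have hε := hpar.ε_pos
  have hf := hpar.f_pos
  have hγ := hpar.one_le_γ
  have hτ := hpar.one_le_τ
  have hlam := hpar.lam_pos
  have hp := p_pos par
  have hz := hpar.tilt_pos
  have hz2 := hpar.tilt_le
  have hrate := hpar.rate_ge hl
  set θ := par.tilt * par.f / (2 * par.γ ^ 2 * par.p * m) with hθ
  have hθ0 : 0 < θ := by positivity
  have hcum : ∀ R ∈ S, ∀ e ∈ R.log, e.party.isLeft →
      cumulant θ e.query ≤ par.p * θ * (1 + par.tilt / 2 + par.tilt ^ 2 / 4) := by
    intro R hR e he hleft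
    refine cumulant_le _ hθ0.le ?_ (by linarith)
    have h1 := (hgood R hR e he hleft).1
    have h2 : par.p * R.plan.n * e.query.target ≤ par.p * m * e.query.target := by
      gcongr; exact hm R hR
    rw [hθ, div_le_iff₀ (by positivity)]
    have h3 := h1.trans h2
    rw [div_le_iff₀ (by positivity)] at h3
    nlinarith
  have hge := exponent_honest_ge hS θ _ hcum
  have hN := length_mul_le_sumN hμ
  have hw : 0 < 1 + par.ε - (1 + par.tilt / 2 + par.tilt ^ 2 / 4) := by
    have h := hpar.sq_le_tilt
    have : 0 < par.ε ^ 2 := by positivity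
    exact pos_of_mul_pos_right (pos_of_mul_pos_right (this.trans_le h) (by positivity)) hz.le
  set w := 1 + par.ε - (1 + par.tilt / 2 + par.tilt ^ 2 / 4) with hwdef
  calc par.γ ^ 2 * (μ / m) * par.lam
      = μ / (2 * par.γ ^ 2 * m) * (2 * (par.lam * 1 * par.γ ^ 4)) := by field_simp
    _ ≤ μ / (2 * par.γ ^ 2 * m) * (2 * (par.lam * par.τ * par.γ ^ 4)) := by gcongr
    _ ≤ μ / (2 * par.γ ^ 2 * m) * (S.length * par.f * (par.tilt * w)) := by gcongr
    _ = par.p * θ * (S.length * μ) * w := by rw [hθ]; field_simp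
    _ ≤ par.p * θ * sumN S * w := by gcongr
    _ = θ * ((1 + par.ε) * par.p * sumN S) -
        par.p * θ * (1 + par.tilt / 2 + par.tilt ^ 2 / 4) * sumN S := by rw [hwdef]; ring
    _ ≤ θ * sumD S - par.p * θ * (1 + par.tilt / 2 + par.tilt ^ 2 / 4) * sumN S := by gcongr
    _ ≤ _ := hge

/-- Adversarial queries only have to break even, as there may be none; the honest ones supply the
surplus. Hence adversarial ratios `θ / T` may go up to `2 z`, with `z = tilt`, because `1 + z + z ^
2 ≤ 1 + ε`; this allows `y ≤ 2`. The condition `y ≤ γ` keeps honest ratios below `z`. A larger `y`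
yields a larger exponent. -/
lemma total_exponent_of_deviation (hpar : par.Valid) (hS : ∀ R ∈ S, R.Complete)
    (hgood : ∀ R ∈ S, R.Good) (hadv : ∀ R ∈ S, R.AdvBounded) (hl : par.ell ≤ S.length)
    {m μ y : ℝ} (hm0 : 0 < m) (hμ0 : 0 < μ)
    (hm : ∀ R ∈ S, (R.plan.n : ℝ) ≤ m) (hμ : ∀ R ∈ S, μ ≤ R.plan.n)
    (hy0 : 0 < y) (hy2 : y ≤ 2) (hy : y ≤ par.γ)
    (hdev : (1 + par.ε) * par.p * (sumN S + sumJ S) ≤ sumD S + sumA S) :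
    y * par.γ * (μ / m) * par.lam ≤ exponent (fun _ => Set.univ)
      (y * par.tilt * par.f / (2 * par.τ * par.γ ^ 3 * par.p * m)) S := by
  have hε := hpar.ε_pos
  have hf := hpar.f_pos
  have hγ := hpar.one_le_γ
  have hτ := hpar.one_le_τ
  have hlam := hpar.lam_pos
  have hp := p_pos par
  have hz := hpar.tilt_pos
  have hz2 := hpar.tilt_le
  have hrate := hpar.rate_ge hl
  set θ := y * par.tilt * par.f / (2 * par.τ * par.γ ^ 3 * par.p * m) with hθ
  have hθ0 : 0 < θ := by positivity
  have hle : ∀ R ∈ S, ∀ e ∈ R.log,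
      par.p * R.plan.n * e.query.target ≤ par.p * m * e.query.target := by
    intro R hR e _
    gcongr; exact hm R hR
  have hcum : ∀ R ∈ S, ∀ e ∈ R.log, e.party.isLeft →
      cumulant θ e.query ≤ par.p * θ * (1 + par.tilt / 2 + par.tilt ^ 2 / 4) := by
    intro R hR e he hleft
    refine cumulant_le _ hθ0.le ?_ (by linarith)
    have h3 := (hgood R hR e he hleft).1.trans (hle R hR e he)
    rw [hθ, div_le_iff₀ (by positivity)]
    rw [div_le_iff₀ (by positivity)] at h3
    calc y * par.tilt * par.f ≤ (par.γ * par.τ) * par.tilt *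
          (par.p * m * e.query.target * (2 * par.γ ^ 2)) := by
          gcongr
          nlinarith
      _ = _ := by ring
  have hcum' : ∀ R ∈ S, ∀ e ∈ R.log, e.party.isRight →
      cumulant θ e.query ≤ par.p * θ * (1 + par.ε) := by
    intro R hR e he hright
    refine (cumulant_le (v := 2 * par.tilt) _ hθ0.le ?_ (by linarith)).trans ?_
    · have h3 := (hadv R hR e he hright).1.trans (hle R hR e he)
      rw [hθ, div_le_iff₀ (by positivity)]
      rw [div_le_iff₀ (by positivity)] at h3
      calc y * par.tilt * par.f ≤ 2 * par.tilt *
            (par.p * m * e.query.target * (2 * par.τ * par.γ ^ 3)) := by gcongr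
        _ = _ := by ring
    · have hmul := hpar.tilt_mul
      have hle' : par.tilt ≤ par.ε := by nlinarith
      exact mul_le_mul_of_nonneg_left (by nlinarith) (by positivity)
  have hge := exponent_total_ge hS θ _ _ hcum hcum'
  have hN := length_mul_le_sumN hμ
  have hw : 0 < 1 + par.ε - (1 + par.tilt / 2 + par.tilt ^ 2 / 4) := by
    have h := hpar.sq_le_tilt
    have : 0 < par.ε ^ 2 := by positivity
    exact pos_of_mul_pos_right (pos_of_mul_pos_right (this.trans_le h) (by positivity)) hz.le
  set w := 1 + par.ε - (1 + par.tilt / 2 + par.tilt ^ 2 / 4) with hwdef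
  calc y * par.γ * (μ / m) * par.lam
      = y * μ / (2 * par.τ * par.γ ^ 3 * m) * (2 * (par.lam * par.τ * par.γ ^ 4)) := by
        field_simp
    _ ≤ y * μ / (2 * par.τ * par.γ ^ 3 * m) * (S.length * par.f * (par.tilt * w)) := by gcongr
    _ = par.p * θ * (S.length * μ) * w := by rw [hθ]; field_simp
    _ ≤ par.p * θ * sumN S * w := by gcongr
    _ = θ * ((1 + par.ε) * par.p * (sumN S + sumJ S)) -
        (par.p * θ * (1 + par.tilt / 2 + par.tilt ^ 2 / 4) * sumN S +
          par.p * θ * (1 + par.ε) * sumJ S) := by rw [hwdef]; ring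
    _ ≤ θ * (sumD S + sumA S) -
        (par.p * θ * (1 + par.tilt / 2 + par.tilt ^ 2 / 4) * sumN S +
          par.p * θ * (1 + par.ε) * sumJ S) := by gcongr
    _ ≤ _ := hge

/-- The lower tail loses `ε / 2` to the quadratic term of the cumulant and `ε / (2 ρ)` to the level
`λ`. The second loss shrinks as the window grows, so windows with `ρ > 1` have slack to spare. -/
lemma sumDH_gt_of_exponent_lt (hpar : par.Valid) (hS : ∀ R ∈ S, R.Complete)
    (hgood : ∀ R ∈ S, R.Good) {ρ : ℝ} (hρ : 0 < ρ) (hl : ρ * par.ellFraction ≤ S.length) {n : ℝ}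
    (hn : 0 < n) (hm : ∀ R ∈ S, (R.plan.n : ℝ) ≤ par.γ * n)
    (hμ : ∀ R ∈ S, n / par.γ ≤ R.plan.n)
    (hexp : exponent fractionParties (-(par.ε * par.f / (2 * par.γ ^ 3 * par.p * n))) S <
      par.lam) :
    (1 - par.ε / 2 - par.ε / (2 * ρ)) * par.p * sumNH S < sumDH S := by
  have hε := hpar.ε_pos
  have hf := hpar.f_pos
  have hγ := hpar.one_le_γ
  have hτ := hpar.one_le_τ
  have hlam := hpar.lam_pos
  have hp := p_pos par
  have hφ := hpar.fraction_pos
  set θ := par.ε * par.f / (2 * par.γ ^ 3 * par.p * n) with hθ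
  have hθ0 : 0 < θ := by positivity
  have hcum : ∀ R ∈ S, ∀ e ∈ R.log, e.party.isLeft →
      cumulant (-θ) e.query ≤ -(par.p * θ * (1 - par.ε / 2)) := by
    intro R hR e he hleft
    refine cumulant_neg_le _ hθ0.le ?_
    have h1 := (hgood R hR e he hleft).1
    have h2 : par.p * R.plan.n * e.query.target ≤ par.p * (par.γ * n) * e.query.target := by
      gcongr; exact hm R hR
    have h3 := h1.trans h2
    rw [div_le_iff₀ (by positivity)] at h3
    rw [hθ, div_le_iff₀ (by positivity)]
    nlinarith
  have hge := exponent_fraction_ge hS (-θ) _ hcum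
  have hNH : S.length * (par.φ * (2 - par.δ) * (n / par.γ)) ≤ sumNH S := by
    refine length_mul_le_sumNH fun R hR => ?_
    rw [R.plan.H_card]
    refine le_trans ?_ (Nat.le_ceil _)
    gcongr
    exact hμ R hR
  have hell : par.ellFraction * (par.φ * (2 - par.δ)) = par.ell := by
    unfold Params.ellFraction
    exact div_mul_cancel₀ _ hφ.ne'
  have hkey : par.lam ≤ par.ε / (2 * ρ) * (θ * par.p * sumNH S) := by
    calc par.lam = 4 * (1 + 3 * 0) * 1 * par.γ ^ 4 * par.lam / (4 * par.γ ^ 4) := by field_simp; ring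
      _ ≤ 4 * (1 + 3 * par.ε) * par.τ * par.γ ^ 4 * par.lam / (4 * par.γ ^ 4) := by gcongr
      _ ≤ par.ε ^ 2 * par.f * par.ell / (4 * par.γ ^ 4) :=
        div_le_div_of_nonneg_right hpar.ell_ge (by positivity)
      _ = par.ε / (2 * ρ) * (θ * par.p *
          (ρ * par.ellFraction * (par.φ * (2 - par.δ) * (n / par.γ)))) := by
          rw [← hell, hθ]; field_simp; ring
      _ ≤ par.ε / (2 * ρ) * (θ * par.p *
          (S.length * (par.φ * (2 - par.δ) * (n / par.γ)))) := by gcongr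
      _ ≤ _ := by gcongr
  refine lt_of_mul_lt_mul_left ?_ hθ0.le
  linarith

end Deviations

/-! ### Cutting long windows into pieces. -/

/-- An additive property of lists that holds for the pieces of length in `[k, 2 k)` holds for all
lists of length at least `k`. -/
lemma of_pieces {α : Type*} {k : ℕ} (hk : 0 < k) (Q : List α → Prop)
    (hadd : ∀ A B, Q A → Q B → Q (A ++ B)) (S : List α)
    (hQ : ∀ S', S' <:+: S → k ≤ S'.length → S'.length < 2 * k → Q S') (hS : k ≤ S.length) :
    Q S := by
  induction hn : S.length using Nat.strong_induction_on generalizing S with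
  | _ n ih =>
    by_cases h : S.length < 2 * k
    · exact hQ S (List.infix_refl S) hS h
    · have hlen : (S.drop k).length = S.length - k := List.length_drop
      rw [← List.take_append_drop k S]
      refine hadd _ _ (hQ _ (List.take_prefix k S).isInfix ?_ ?_)
        (ih _ ?_ (S.drop k) (fun S' hS' => hQ S' (hS'.trans (List.drop_suffix k S).isInfix)) ?_ rfl)
      · rw [List.length_take]; omega
      · rw [List.length_take]; omega
      · omega
      · omega

lemma of_real_pieces {α : Type*} {l : ℝ} (hl : 0 < l) (Q : List α → Prop)
    (hadd : ∀ A B, Q A → Q B → Q (A ++ B)) (S : List α)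
    (hQ : ∀ S', S' <:+: S → l ≤ S'.length → (S'.length : ℝ) < 2 * l + 1 → Q S')
    (hS : l ≤ S.length) : Q S := by
  refine of_pieces (Nat.ceil_pos.2 hl) Q hadd S (fun S' hS' h1 h2 => ?_) (Nat.ceil_le.2 hS)
  refine hQ S' hS' (Nat.ceil_le.1 h1) ?_
  -- Strictness between integers saves one: the length is at most `2 ⌈l⌉ - 1 < 2 l + 1`, not merely
  -- below `2 l + 2`.
  have h3 : (S'.length : ℝ) + 1 ≤ 2 * ⌈l⌉₊ := by exact_mod_cast h2
  have := Nat.ceil_lt_add_one hl.le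
  linarith

lemma Params.Valid.ell_le_s (hpar : par.Valid) : 8 * par.ell ≤ par.s := by
  have hε := hpar.ε_pos
  have hε1 := hpar.ε_lt_one
  have hf := hpar.f_pos
  have hγ := hpar.one_le_γ
  have hδ := hpar.δ_pos
  have hell := hpar.ell_pos
  have h : par.s = 8 * ((1 + par.δ) ^ 2 * par.γ ^ 4 * (par.ell + 3 * par.Δ)) / par.ε := by
    unfold Params.s Params.epoch
    field_simp
    ring
  rw [h, le_div_iff₀ hε]
  have h1 : (1 : ℝ) ≤ (1 + par.δ) ^ 2 := one_le_pow₀ (by linarith)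
  have h2 : (1 : ℝ) ≤ par.γ ^ 4 := one_le_pow₀ hγ
  calc 8 * par.ell * par.ε ≤ 8 * par.ell * 1 := by gcongr
    _ = 8 * (1 * 1 * (par.ell + 3 * 0)) := by ring
    _ ≤ _ := by gcongr; positivity

/-! ### Windows of at most about `s` rounds. -/

section Windows

variable {R : RoundRecord par} {S : List (RoundRecord par)}

lemma sumD_lt_of_exponent_lt (hpar : par.Valid) (hS : ∀ Q ∈ R :: S, Q.Complete)
    (hgood : ∀ Q ∈ R :: S, Q.Good) (hl : par.ell ≤ (R :: S).length)
    (hresp : ∀ a ∈ R :: S, ∀ b ∈ R :: S, (a.plan.n : ℝ) ≤ par.γ * b.plan.n)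
    (hexp : exponent honestParties
      (par.tilt * par.f / (2 * par.γ ^ 2 * par.p * (par.γ * R.plan.n))) (R :: S) < par.lam) :
    sumD (R :: S) < (1 + par.ε) * par.p * sumN (R :: S) := by
  have hγ := hpar.one_le_γ
  have hn : (0 : ℝ) < R.plan.n := by exact_mod_cast R.plan.n_pos
  by_contra! hdev
  have h := honest_exponent_of_deviation hpar hS hgood hl (m := par.γ * R.plan.n)
    (μ := R.plan.n / par.γ) (by positivity) (by positivity)
    (fun Q hQ => hresp Q hQ R List.mem_cons_self)
    (fun Q hQ => by
      rw [div_le_iff₀' (by positivity)]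
      exact hresp R List.mem_cons_self Q hQ) hdev
  have h1 : par.γ ^ 2 * (R.plan.n / par.γ / (par.γ * R.plan.n)) = 1 := by field_simp
  rw [h1, one_mul] at h
  linarith

/-- For every round a few tilting parameters suffice for the upper tail of all queries: one of them
fits the largest number of parties in the set of rounds. -/
lemma exists_tilts (hpar : par.Valid) (hlarge : par.ell ≤ Real.exp par.lam) (hlam1 : 1 ≤ par.lam) :
    ∃ (K : ℕ) (θ : ℕ → ℕ → ℝ) (c : ℝ), K * Real.exp (-c) ≤ 3 * Real.exp (-par.lam) ∧
      ∀ (R : RoundRecord par) (S : List (RoundRecord par)), (∀ Q ∈ R :: S, Q.Complete) →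
        (∀ Q ∈ R :: S, Q.Good) → (∀ Q ∈ R :: S, Q.AdvBounded) → par.ell ≤ (R :: S).length →
        (∀ a ∈ R :: S, ∀ b ∈ R :: S, (a.plan.n : ℝ) ≤ par.γ * b.plan.n) →
        (∀ j < K, exponent (fun _ => Set.univ) (θ j R.plan.n) (R :: S) < c) →
        sumD (R :: S) + sumA (R :: S) < (1 + par.ε) * par.p * (sumN (R :: S) + sumJ (R :: S)) := by
  have hγ := hpar.one_le_γ
  have hlam := hpar.lam_pos
  by_cases hγ2 : par.γ ≤ 2
  · refine ⟨1, fun _ n => par.γ * par.tilt * par.f /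
      (2 * par.τ * par.γ ^ 3 * par.p * (par.γ * n)), par.lam, ?_, ?_⟩
    · have := Real.exp_pos (-par.lam)
      push_cast
      linarith
    · intro R S hS hgood hadv hl hresp hexp
      have hn : (0 : ℝ) < R.plan.n := by exact_mod_cast R.plan.n_pos
      by_contra! hdev
      have h := total_exponent_of_deviation hpar hS hgood hadv hl (m := par.γ * R.plan.n)
        (μ := R.plan.n / par.γ) (y := par.γ) (by positivity) (by positivity)
        (fun Q hQ => hresp Q hQ R List.mem_cons_self)
        (fun Q hQ => by
          rw [div_le_iff₀' (by positivity)]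
          exact hresp R List.mem_cons_self Q hQ) (by positivity) hγ2 le_rfl hdev
      have h1 : par.γ * par.γ * (R.plan.n / par.γ / (par.γ * R.plan.n)) = 1 := by field_simp
      rw [h1, one_mul] at h
      linarith [hexp 0 one_pos]
  · push Not at hγ2
    -- The scales `n (1 + (j + 1) / 2)` have spacing `n / 2`, so one of them lies between the
    -- maximum `M ≥ n` of the window and `3 M / 2`. Since the minimum is at least `M / γ`, the
    -- choice `y = 2` gives exponent at least `4 λ / 3`.
    refine ⟨⌈2 * par.γ⌉₊, fun j n => 2 * par.tilt * par.f /
      (2 * par.τ * par.γ ^ 3 * par.p * (n * (1 + (j + 1) / 2))), 4 / 3 * par.lam, ?_, ?_⟩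
    · have h1 : (⌈2 * par.γ⌉₊ : ℝ) ≤ 3 * par.γ := by
        have := Nat.ceil_lt_add_one (a := 2 * par.γ) (by positivity)
        linarith
      -- The extra `λ / 3` in the level pays for a union over at most `3 γ` scales, since `4 γ ^ 6 λ
      -- ≤ ℓ ≤ exp λ` gives `γ ^ 3 ≤ exp λ`.
      have h2 : par.γ ≤ Real.exp (par.lam / 3) := by
        refine le_of_pow_le_pow_left₀ (n := 3) (by norm_num) (Real.exp_pos _).le ?_
        rw [← Real.exp_nat_mul]
        have h3 := hpar.pow_mul_lam_le_ell
        have h4 : par.γ ^ 3 ≤ par.γ ^ 6 := pow_le_pow_right₀ hγ (by norm_num)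
        have h5 : 0 < par.γ ^ 6 := by positivity
        have h6 : ((3 : ℕ) : ℝ) * (par.lam / 3) = par.lam := by push_cast; ring
        rw [h6]
        nlinarith
      calc (⌈2 * par.γ⌉₊ : ℝ) * Real.exp (-(4 / 3 * par.lam))
          ≤ 3 * Real.exp (par.lam / 3) * Real.exp (-(4 / 3 * par.lam)) := by
            gcongr
            linarith
        _ = 3 * Real.exp (-par.lam) := by
            rw [mul_assoc, ← Real.exp_add]
            ring_nf
    · intro R S hS hgood hadv hl hresp hexp
      have hn : (0 : ℝ) < R.plan.n := by exact_mod_cast R.plan.n_pos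
      by_contra! hdev
      obtain ⟨M, hM, hmax⟩ := Set.exists_max_image {Q | Q ∈ R :: S}
        (fun Q : RoundRecord par => (Q.plan.n : ℝ)) (List.finite_toSet _) ⟨R, List.mem_cons_self⟩
      have hRM : (R.plan.n : ℝ) ≤ M.plan.n := hmax R List.mem_cons_self
      have hMR : (M.plan.n : ℝ) ≤ par.γ * R.plan.n := hresp M hM R List.mem_cons_self
      have hM0 : (0 : ℝ) < M.plan.n := hn.trans_le hRM
      have hr0 : 0 ≤ 2 * ((M.plan.n : ℝ) / R.plan.n - 1) := by
        have : 1 ≤ (M.plan.n : ℝ) / R.plan.n := (one_le_div hn).2 hRM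
        linarith
      set j := ⌊2 * ((M.plan.n : ℝ) / R.plan.n - 1)⌋₊ with hj
      have hj1 : (j : ℝ) ≤ 2 * ((M.plan.n : ℝ) / R.plan.n - 1) := Nat.floor_le hr0
      have hj2 : 2 * ((M.plan.n : ℝ) / R.plan.n - 1) < j + 1 := Nat.lt_floor_add_one _
      have hMdiv : (M.plan.n : ℝ) = M.plan.n / R.plan.n * R.plan.n := by field_simp
      have hm1 : (M.plan.n : ℝ) ≤ R.plan.n * (1 + (j + 1) / 2) := by
        nlinarith
      have hm2 : R.plan.n * (1 + ((j : ℝ) + 1) / 2) ≤ 3 / 2 * M.plan.n := by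
        nlinarith
      have hjK : j < ⌈2 * par.γ⌉₊ := by
        rw [Nat.lt_ceil]
        have : (M.plan.n : ℝ) / R.plan.n ≤ par.γ := (div_le_iff₀ hn).2 hMR
        linarith
      have h := total_exponent_of_deviation hpar hS hgood hadv hl
        (m := R.plan.n * (1 + ((j : ℝ) + 1) / 2)) (μ := M.plan.n / par.γ) (y := 2)
        (by positivity) (by positivity) (fun Q hQ => (hmax Q hQ).trans hm1)
        (fun Q hQ => by
          rw [div_le_iff₀' (by positivity)]
          exact hresp M hM Q hQ) two_pos le_rfl hγ2.le hdev
      have h1 : 4 / 3 ≤ 2 * par.γ * (M.plan.n / par.γ / (R.plan.n * (1 + ((j : ℝ) + 1) / 2))) := by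
        have : 2 * par.γ * (M.plan.n / par.γ / (R.plan.n * (1 + ((j : ℝ) + 1) / 2))) =
            2 * M.plan.n / (R.plan.n * (1 + ((j : ℝ) + 1) / 2)) := by
          field_simp
        rw [this, le_div_iff₀ (by positivity)]
        linarith
      have h2 := mul_le_mul_of_nonneg_right h1 hlam.le
      linarith [hexp j hjK]

/-- Since `H` is nonempty, rounding up at most doubles the bound `γ`. -/
lemma card_H_le (hpar : par.Valid) {a b : RoundRecord par}
    (h : (a.plan.n : ℝ) ≤ par.γ * b.plan.n) :
    (a.plan.H.card : ℝ) ≤ 2 * par.γ * b.plan.H.card := by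
  have hγ := hpar.one_le_γ
  have hφ := hpar.fraction_pos
  have ha : (0 : ℝ) < a.plan.n := by exact_mod_cast a.plan.n_pos
  have hb : (0 : ℝ) < b.plan.n := by exact_mod_cast b.plan.n_pos
  rw [a.plan.H_card, b.plan.H_card]
  have h1 := Nat.ceil_lt_add_one (a := par.φ * (2 - par.δ) * a.plan.n) (by positivity)
  have h2 := Nat.le_ceil (par.φ * (2 - par.δ) * b.plan.n)
  have h3 : (1 : ℝ) ≤ ⌈par.φ * (2 - par.δ) * b.plan.n⌉₊ := by
    exact_mod_cast Nat.ceil_pos.2 (by positivity)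
  have h4 : par.φ * (2 - par.δ) * a.plan.n ≤ par.γ * (par.φ * (2 - par.δ) * b.plan.n) := by
    calc _ ≤ par.φ * (2 - par.δ) * (par.γ * b.plan.n) := by gcongr
      _ = _ := by ring
  nlinarith

/-- The tilting parameter for the lower tail. -/
def lowerTilt (par : Params) (n : ℕ) : ℝ := -(par.ε * par.f / (2 * par.γ ^ 3 * par.p * n))

lemma sumDH_gt_of_length_le (hpar : par.Valid) (hS : ∀ Q ∈ R :: S, Q.Complete)
    (hgood : ∀ Q ∈ R :: S, Q.Good) {ρ : ℝ} (hρ : 0 < ρ)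
    (hl : ρ * par.ellFraction ≤ (R :: S).length)
    (hresp : ∀ a ∈ R :: S, ∀ b ∈ R :: S, (a.plan.n : ℝ) ≤ par.γ * b.plan.n)
    (hexp : exponent fractionParties (lowerTilt par R.plan.n) (R :: S) < par.lam) :
    (1 - par.ε / 2 - par.ε / (2 * ρ)) * par.p * sumNH (R :: S) < sumDH (R :: S) := by
  have hγ := hpar.one_le_γ
  have hn : (0 : ℝ) < R.plan.n := by exact_mod_cast R.plan.n_pos
  exact sumDH_gt_of_exponent_lt hpar hS hgood hρ hl hn
    (fun Q hQ => hresp Q hQ R List.mem_cons_self)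
    (fun Q hQ => by
      rw [div_le_iff₀' (by positivity)]
      exact hresp R List.mem_cons_self Q hQ) hexp

/-- One more round than a window of length `s` does no harm, as it is longer than
`2 ℓ / (φ (2 - δ))`. -/
lemma sumDH_gt_append_singleton (hpar : par.Valid) (hlam8 : 8 ≤ par.lam) {Z : RoundRecord par}
    (hS : ∀ Q ∈ R :: S, Q.Complete) (hgood : ∀ Q ∈ R :: S, Q.Good)
    (hl : 2 * par.ellFraction < (R :: (S ++ [Z])).length)
    (hresp : ∀ a ∈ R :: S, ∀ b ∈ R :: S, (a.plan.n : ℝ) ≤ par.γ * b.plan.n)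
    (hresp' : ∀ b ∈ S, (Z.plan.n : ℝ) ≤ par.γ * b.plan.n)
    (hexp : exponent fractionParties (lowerTilt par R.plan.n) (R :: S) < par.lam) :
    (1 - par.ε) * par.p * sumNH (R :: (S ++ [Z])) < sumDH (R :: (S ++ [Z])) := by
  have hγ := hpar.one_le_γ
  have hε := hpar.ε_pos
  have hε1 := hpar.ε_lt_one
  have hp := p_pos par
  have hell := hpar.ell_pos
  have hellF := hpar.ell_le_ellFraction
  have hγ6 : 1 ≤ par.γ ^ 5 := one_le_pow₀ hγ
  have hlen1 : 32 * par.γ ≤ par.ε * par.ell := by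
    have h1 := hpar.ell_ge_pow
    have h2 : par.ε ^ 2 * par.ell ≤ par.ε * par.ell := by
      have : 0 < par.ε * par.ell := by positivity
      nlinarith
    have h3 : 4 * par.γ * 1 * 8 ≤ 4 * par.γ * par.γ ^ 5 * par.lam := by gcongr
    linarith [show 4 * par.γ * par.γ ^ 5 * par.lam = 4 * par.γ ^ 6 * par.lam by ring]
  have hell2 : 32 ≤ par.ell := by nlinarith
  simp only [List.length_cons, List.length_append, List.length_nil] at hl
  push_cast at hl
  -- After dropping `Z` the window still has at least `3 / 2` times the minimal length. The losses
  -- are `ε / 2 + ε / 3`, leaving `ε / 6` for the parties of `Z`.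
  have h := sumDH_gt_of_length_le hpar hS hgood (ρ := 3 / 2) (by norm_num)
    (by rw [List.length_cons]; push_cast; linarith) hresp hexp
  have hNH : sumNH (R :: (S ++ [Z])) = sumNH (R :: S) + Z.plan.H.card := by
    simp [sumNH, add_assoc]
  have hDH : sumDH (R :: (S ++ [Z])) = sumDH (R :: S) + Z.DH := by
    simp [sumDH, add_assoc]
  have hZ0 : 0 ≤ Z.DH := difficulty_nonneg Z _
  -- `Z` is compared with the rounds of `S` only: the full window including `R` may be longer than
  -- `s`.
  have hlast : S.length * ((Z.plan.H.card : ℝ) / (2 * par.γ)) ≤ sumNH S := by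
    refine length_mul_le_sumNH fun Q hQ => ?_
    rw [div_le_iff₀' (by positivity)]
    exact card_H_le hpar (hresp' Q hQ)
  have hcons : sumNH S ≤ sumNH (R :: S) := by
    simp [sumNH]
  have hlen2 : 12 * par.γ ≤ par.ε * S.length := by
    have : par.ell ≤ S.length := by linarith
    nlinarith
  have hlast' : (Z.plan.H.card : ℝ) ≤ par.ε / 6 * sumNH (R :: S) := by
    have h1 : (12 * par.γ) * ((Z.plan.H.card : ℝ) / (2 * par.γ)) ≤
        par.ε * S.length * ((Z.plan.H.card : ℝ) / (2 * par.γ)) := by gcongr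
    have h2 : (12 * par.γ) * ((Z.plan.H.card : ℝ) / (2 * par.γ)) = 6 * Z.plan.H.card := by
      field_simp
      ring
    nlinarith
  have hcard : (0 : ℝ) ≤ Z.plan.H.card := Nat.cast_nonneg _
  rw [hNH, hDH]
  have h1 : (1 - par.ε) * Z.plan.H.card ≤ par.ε / 6 * sumNH (R :: S) := by nlinarith
  have h2 := mul_le_mul_of_nonneg_left h1 hp.le
  have h3 : (1 - par.ε / 2 - par.ε / (2 * (3 / 2))) * par.p * sumNH (R :: S) =
    (1 - par.ε) * par.p * sumNH (R :: S) + par.p * (par.ε / 6 * sumNH (R :: S)) := by ring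
  nlinarith

end Windows

/-! ### Assembly: deterministic reduction and union bound. -/

/-- An execution is typical if no exponential supermartingale exceeds its level. -/
lemma fruitTypical_of_exponent_lt (hpar : par.Valid) (hlam8 : 8 ≤ par.lam)
    {E : List (RoundRecord par)} (hE : ∀ R ∈ E, R.Complete) (hresp : IsRespecting par.γ par.s E)
    {K : ℕ} {θ : ℕ → ℕ → ℝ} {c : ℝ}
    (hθ : ∀ (R : RoundRecord par) (S : List (RoundRecord par)), (∀ Q ∈ R :: S, Q.Complete) →
        (∀ Q ∈ R :: S, Q.Good) → (∀ Q ∈ R :: S, Q.AdvBounded) → par.ell ≤ (R :: S).length →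
        (∀ a ∈ R :: S, ∀ b ∈ R :: S, (a.plan.n : ℝ) ≤ par.γ * b.plan.n) →
        (∀ j < K, exponent (fun _ => Set.univ) (θ j R.plan.n) (R :: S) < c) →
        sumD (R :: S) + sumA (R :: S) < (1 + par.ε) * par.p * (sumN (R :: S) + sumJ (R :: S)))
    (hhonest : ∀ R S, R :: S <:+: E → exponent honestParties
      (par.tilt * par.f / (2 * par.γ ^ 2 * par.p * (par.γ * R.plan.n))) (R :: S) < par.lam)
    (htotal : ∀ R S, R :: S <:+: E →
      ∀ j < K, exponent (fun _ => Set.univ) (θ j R.plan.n) (R :: S) < c)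
    (hfraction : ∀ R S, R :: S <:+: E →
      exponent fractionParties (lowerTilt par R.plan.n) (R :: S) < par.lam) :
    FruitTypical E := by
  have hell := hpar.ell_pos
  have hellF := hpar.ell_le_ellFraction
  have hs := hpar.ell_le_s
  have hsF := hpar.ellFraction_le
  have hell1 : 1 ≤ par.ell := by
    have h1 := hpar.pow_mul_lam_le_ell
    have h2 : 1 ≤ par.γ ^ 6 := one_le_pow₀ hpar.one_le_γ
    nlinarith
  constructor
  · intro S hS hgood hl
    refine of_real_pieces hell (fun S => sumD S < (1 + par.ε) * par.p * sumN S) ?_ S ?_ hl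
    · intro A B hA hB
      simp only [sumD, sumN, List.map_append, List.sum_append] at hA hB ⊢
      linarith
    · rintro (_ | ⟨R, S'⟩) hS' h1 h2
      · simp only [List.length_nil, Nat.cast_zero] at h1
        linarith
      · have hin := hS'.trans hS
        exact sumD_lt_of_exponent_lt hpar (fun Q hQ => hE Q (hin.subset hQ))
          (fun Q hQ => hgood Q (hS'.subset hQ)) h1 (hresp _ hin (by linarith)) (hhonest R S' hin)
  · intro S hS hgood hl hadv
    refine of_real_pieces hell (fun S => sumD S + sumA S <
      (1 + par.ε) * par.p * (sumN S + sumJ S)) ?_ S ?_ hl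
    · intro A B hA hB
      simp only [sumD, sumN, sumA, sumJ, List.map_append, List.sum_append] at hA hB ⊢
      linarith
    · rintro (_ | ⟨R, S'⟩) hS' h1 h2
      · simp only [List.length_nil, Nat.cast_zero] at h1
        linarith
      · have hin := hS'.trans hS
        exact hθ R S' (fun Q hQ => hE Q (hin.subset hQ))
          (fun Q hQ => hgood Q (hS'.subset hQ)) (fun Q hQ => hadv Q (hS'.subset hQ)) h1
          (hresp _ hin (by linarith)) (htotal R S' hin)
  · intro S hS hgood hl
    refine of_real_pieces (hell.trans_le hellF)
      (fun S => (1 - par.ε) * par.p * sumNH S < sumDH S) ?_ S ?_ hl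
    · intro A B hA hB
      simp only [sumDH, sumNH, List.map_append, List.sum_append] at hA hB ⊢
      linarith
    · rintro (_ | ⟨R, S'⟩) hS' h1 h2
      · simp only [List.length_nil, Nat.cast_zero] at h1
        linarith
      have hin := hS'.trans hS
      by_cases hlen : ((R :: S').length : ℝ) ≤ par.s
      · have h := sumDH_gt_of_length_le hpar (fun Q hQ => hE Q (hin.subset hQ))
          (fun Q hQ => hgood Q (hS'.subset hQ)) one_pos (by linarith)
          (hresp _ hin hlen) (hfraction R S' hin)
        rwa [mul_one, sub_sub, add_halves] at h
      -- The piece has fewer than `2 * ellFraction + 1 ≤ s + 1` rounds, so removing either its first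
      -- or its last round leaves at most `s`.
      · push Not at hlen
        rcases List.eq_nil_or_concat' S' with rfl | ⟨S'', Z, rfl⟩
        · simp only [List.length_cons, List.length_nil] at hlen
          push_cast at hlen
          linarith
        · have hpre : R :: S'' <:+: R :: (S'' ++ [Z]) := ⟨[], [Z], by simp⟩
          have hsuf : S'' ++ [Z] <:+: R :: (S'' ++ [Z]) := ⟨[R], [], by simp⟩
          have hshort : ((S''.length : ℝ) + 1) ≤ par.s := by
            simp only [List.length_cons, List.length_append, List.length_nil] at h2
            push_cast at h2
            linarith
          exact sumDH_gt_append_singleton hpar hlam8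
            (fun Q hQ => hE Q (hin.subset (hpre.subset hQ)))
            (fun Q hQ => hgood Q (hS'.subset (hpre.subset hQ))) (by linarith)
            (hresp _ (hpre.trans hin) (by simpa using hshort))
            (fun b hb => hresp _ (hsuf.trans hin) (by simpa using hshort) Z (by simp) b
              (by simp [hb])) (hfraction R S'' (hpre.trans hin))

/-- The union bound over the exponential supermartingales. -/
lemma prob_not_fruitTypical_le (hpar : par.Valid) (hlam8 : 8 ≤ par.lam) (sys : System par State)
    (L : ℕ) (hlarge : par.ell ≤ Real.exp par.lam) (hsys : sys.Respecting L par.γ par.s) :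
    (sys.execution L).toOuterMeasure {E | ¬ FruitTypical E} ≤
      L * ENNReal.ofReal (5 * Real.exp (-par.lam)) := by
  obtain ⟨K, θ, c, hK, hθ⟩ := exists_tilts hpar hlarge (by linarith)
  set upper : ℕ → ℝ := fun n => par.tilt * par.f / (2 * par.γ ^ 2 * par.p * (par.γ * n))
  let B (A : (P : RoundPlan par) → Set P.Party) (t : ℕ → ℝ) (c : ℝ) : Set (List (RoundRecord par)) :=
    {E | ∃ R S, R :: S <:+: E ∧ c ≤ exponent A (t R.plan.n) (R :: S)}
  have hB : ∀ A t c, (sys.execution L).toOuterMeasure (B A t c) ≤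
      L * ENNReal.ofReal (Real.exp (-c)) := fun A t c => prob_exists_anchored_infix_le sys A t c L
  calc (sys.execution L).toOuterMeasure {E | ¬ FruitTypical E}
      ≤ (sys.execution L).toOuterMeasure ((B honestParties upper par.lam ∪
          B fractionParties (lowerTilt par) par.lam) ∪
          ⋃ j ∈ Finset.range K, B (fun _ => Set.univ) (θ j) c) := by
        -- Only executions in the support matter; there completeness and the respecting condition
        -- are available.
        refine PMF.toOuterMeasure_mono _ ?_
        rintro E ⟨hE, hsupp⟩
        by_contra hnot
        simp only [Set.mem_union, Set.mem_iUnion, not_or, not_exists, Finset.mem_range] at hnot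
        obtain ⟨⟨h1, h2⟩, h3⟩ := hnot
        refine hE (fruitTypical_of_exponent_lt hpar hlam8
          (of_mem_support_execution sys L E hsupp).2 (hsys E hsupp) hθ ?_ ?_ ?_)
        · intro R S hS
          by_contra! h
          exact h1 ⟨R, S, hS, h⟩
        · intro R S hS j hj
          by_contra! h
          exact h3 j hj ⟨R, S, hS, h⟩
        · intro R S hS
          by_contra! h
          exact h2 ⟨R, S, hS, h⟩
    _ ≤ (L * ENNReal.ofReal (Real.exp (-par.lam)) + L * ENNReal.ofReal (Real.exp (-par.lam))) +
          ∑ j ∈ Finset.range K, L * ENNReal.ofReal (Real.exp (-c)) := by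
        refine (MeasureTheory.measure_union_le _ _).trans (add_le_add
          ((MeasureTheory.measure_union_le _ _).trans (add_le_add (hB _ _ _) (hB _ _ _))) ?_)
        exact (MeasureTheory.measure_biUnion_finset_le _ _).trans
          (Finset.sum_le_sum fun j _ => hB _ _ _)
    _ = L * ENNReal.ofReal (2 * Real.exp (-par.lam) + K * Real.exp (-c)) := by
        rw [ENNReal.ofReal_add (by positivity) (by positivity), two_mul,
          ENNReal.ofReal_add (by positivity) (by positivity), ENNReal.ofReal_mul (by positivity),
          ENNReal.ofReal_natCast, Finset.sum_const, Finset.card_range, nsmul_eq_mul]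
        ring
    _ ≤ L * ENNReal.ofReal (5 * Real.exp (-par.lam)) := by
        gcongr
        linarith

/-- With fewer than `ℓ` rounds no window is long enough, so all three conditions are vacuous on the
support. -/
lemma prob_not_fruitTypical_eq_zero (hpar : par.Valid) (sys : System par State) (L : ℕ)
    (hL : (L : ℝ) < par.ell) :
    (sys.execution L).toOuterMeasure {E | ¬ FruitTypical E} = 0 := by
  rw [PMF.toOuterMeasure_apply_eq_zero_iff, Set.disjoint_left]
  intro E hsupp hE
  have hlen : ∀ S, S <:+: E → (S.length : ℝ) < par.ell := by
    intro S hS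
    refine lt_of_le_of_lt ?_ hL
    rw [← (of_mem_support_execution sys L E hsupp).1]
    exact_mod_cast hS.length_le
  refine hE ⟨fun S hS _ hl => ?_, fun S hS _ hl => ?_, fun S hS _ hl => ?_⟩
  · linarith [hlen S hS]
  · linarith [hlen S hS]
  · linarith [hlen S hS, hpar.ell_le_ellFraction]

end FruitChains
end

theorem mainTheorem8 :
    ∃ C : ℝ, 0 < C ∧
      ∀ (par : FruitChains.Params), par.Valid →
      ∀ (State : Type) (sys : FruitChains.System par State) (L : ℕ),
        sys.Respecting L par.γ par.s →
          (sys.execution L).toOuterMeasure {E | ¬ FruitChains.FruitTypical E} ≤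
            ENNReal.ofReal (C * L * Real.exp (-par.lam)) := by
  -- The constant makes the bound trivial unless `exp 8 * L < exp λ`. In the remaining case with `ℓ
  -- ≤ L`, this yields both `8 ≤ λ` and `ℓ ≤ exp λ`, as the union bound requires. Its own constant 5
  -- is 1 each for (a) and (c) plus 3 for (b).
  refine ⟨Real.exp 8, Real.exp_pos _, fun par hpar State sys L hsys => ?_⟩
  by_cases hL : (L : ℝ) < par.ell
  · rw [FruitChains.prob_not_fruitTypical_eq_zero hpar sys L hL]
    exact zero_le
  push Not at hL
  by_cases htriv : 1 ≤ Real.exp 8 * L * Real.exp (-par.lam)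
  · exact (FruitChains.toOuterMeasure_le_one _ _).trans (ENNReal.one_le_ofReal.2 htriv)
  push Not at htriv
  have hL1 : (1 : ℝ) ≤ L := by
    have : (0 : ℝ) < L := hpar.ell_pos.trans_le hL
    exact_mod_cast this
  have h8 : (8 : ℝ) + 1 ≤ Real.exp 8 := Real.add_one_le_exp 8
  have hmul : Real.exp 8 * L < Real.exp par.lam := by
    rw [Real.exp_neg, ← div_eq_mul_inv, div_lt_one (Real.exp_pos _)] at htriv
    exact htriv
  have hlam8 : 8 ≤ par.lam := by
    rw [← Real.exp_le_exp]
    nlinarith [Real.exp_pos 8]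
  have hlarge : par.ell ≤ Real.exp par.lam := by nlinarith
  refine (FruitChains.prob_not_fruitTypical_le hpar hlam8 sys L hlarge hsys).trans ?_
  rw [← ENNReal.ofReal_natCast, ← ENNReal.ofReal_mul (by positivity)]
  refine ENNReal.ofReal_le_ofReal ?_
  have := Real.exp_pos (-par.lam)
  calc L * (5 * Real.exp (-par.lam)) = 5 * L * Real.exp (-par.lam) := by ring
    _ ≤ Real.exp 8 * L * Real.exp (-par.lam) := by gcongr; linarith
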